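/- Let $\mathbb F$ be a field of characteristic different from $2$. Let $E$ be the Grassmann algebra without identity, that is, the associative $\mathbb F$-algebra generated by $e_1,e_2,\ldots$ with relations $e_ie_j=-e_je_i$ and $e_i^2=0$ for all $i,j$, and let $E^1$ be the Grassmann algebra with identity element $1$ adjoined. Let $E_0$ and $E_1$ be the spans of the products of generators in $E$ of even (positive) and of odd length, respectively, and let $E_0^1=E_0+\mathbb F\cdot 1$. Let $M_{1,1}(E)$ be the algebra of all matrices $\begin{pmatrix} a & b\\ d & c\end{pmatrix}$ with $a,c\in E_0$ and $b,d\in E_1$, and let $M_{1,1}(E^1)$ be the algebra of all such matrices with $a,c\in E_0^1$ and $b,d\in E_1$. Both are regarded as Lie algebras over $\mathbb F$ with the bracket $[A,B]=AB-BA$. Let $L(X)$ be the free Lie algebra over $\mathbb F$ on a countable set $X=\{x_1,x_2,\ldots\}$. An element $f\in L(X)$ is an identity of a Lie algebra $L$ if it vanishes under every substitution of elements of $L$ for the variables. It is multilinear if, for some finite set $S\subset X$, it is a linear combination of Lie monomials in each of which every variable of $S$ occurs exactly once and no other variable occurs. It is a consequence of an identity $g=0$, $g\in L(X)$, if it lies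 in the ideal of $L(X)$ generated by all elements obtained from $g$ by substituting elements of $L(X)$ for the variables. Then every multilinear element $f\in L(X)$ that is an identity of the Lie algebra $M_{1,1}(E)$ or of the Lie algebra $M_{1,1}(E^1)$ is a consequence of the identity $$[x,y,[z,t],u]=[[[x,y],[z,t]],u]=0 .$$ -/

import Mathlib

/-! ### Lie words, multilinear Lie polynomials, identities and consequences -/

namespace LiePI

section FreeLie

variable (F : Type*) [Field F]

/-- The Lie monomial in the free Lie algebra on `x₀, x₁, …` given by a bracketed word. -/
noncomputable def lieMonomial : FreeMagma ℕ → FreeLieAlgebra F ℕ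
  | FreeMagma.of i => FreeLieAlgebra.of F i
  | FreeMagma.mul v w => ⁅lieMonomial v, lieMonomial w⁆

/-- The degree of a bracketed word in the variable `xᵢ`: the number of times `xᵢ` occurs. -/
def wordDegree (i : ℕ) : FreeMagma ℕ → ℕ
  | FreeMagma.of j => if j = i then 1 else 0
  | FreeMagma.mul v w => wordDegree i v + wordDegree i w

variable {F}

/-- A Lie polynomial is multilinear if, for some finite set `s` of variables, it is a linear
combination of Lie monomials of degree one in every variable of `s` and of degree zero in every
other variable. -/
def IsMultilinear (f : FreeLieAlgebra F ℕ) : Prop :=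
  ∃ s : Finset ℕ,
    f ∈ Submodule.span F
      {h : FreeLieAlgebra F ℕ | ∃ w : FreeMagma ℕ,
        (∀ i, wordDegree i w = if i ∈ s then 1 else 0) ∧ lieMonomial F w = h}

/-- `f = 0` is a polynomial identity of the Lie algebra `L`: `f` vanishes under every
substitution of elements of `L` for the variables. -/
def IsIdentity (L : Type*) [LieRing L] [LieAlgebra F L] (f : FreeLieAlgebra F ℕ) : Prop :=
  ∀ a : ℕ → L, FreeLieAlgebra.lift F a f = 0

/-- The verbal ideal (T-ideal) of the free Lie algebra generated by `g`: the ideal generated by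
all the elements `g(b₀, b₁, …)`, where `b₀, b₁, …` are elements of the free Lie algebra. -/
noncomputable def verbalIdeal (g : FreeLieAlgebra F ℕ) : LieIdeal F (FreeLieAlgebra F ℕ) :=
  LieSubmodule.lieSpan F (FreeLieAlgebra F ℕ)
    {h : FreeLieAlgebra F ℕ | ∃ b : ℕ → FreeLieAlgebra F ℕ, FreeLieAlgebra.lift F b g = h}

/-- The identity `f = 0` is a consequence of the identity `g = 0`. -/
def IsConsequence (f g : FreeLieAlgebra F ℕ) : Prop :=
  f ∈ verbalIdeal g

variable (F)

/-- The centre-by-metabelian polynomial `[x, y, [z, t], u]` with left-normed brackets, that is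
`[[[x, y], [z, t]], u]`. -/
noncomputable def centreByMetabelian : FreeLieAlgebra F ℕ :=
  let x := FreeLieAlgebra.of F 0
  let y := FreeLieAlgebra.of F 1
  let z := FreeLieAlgebra.of F 2
  let t := FreeLieAlgebra.of F 3
  let u := FreeLieAlgebra.of F 4
  ⁅⁅⁅x, y⁆, ⁅z, t⁆⁆, u⁆

end FreeLie

/-! ### The Grassmann algebra and the algebras `M₁,₁` -/

section Grassmann

variable (F : Type*) [Field F]

/-- The Grassmann algebra with identity element on countably many generators. -/
abbrev GrassmannOne : Type _ := ExteriorAlgebra F (ℕ →₀ F)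

/-- The generator `eᵢ` of the Grassmann algebra. -/
noncomputable def gen (i : ℕ) : GrassmannOne F :=
  ExteriorAlgebra.ι F (Finsupp.single i 1)

/-- The span of all products `e_{i₁} ⋯ e_{iₙ}` of generators whose length `n` satisfies `P`
(the empty product is `1`). -/
noncomputable def lengthSpan (P : ℕ → Prop) : Submodule F (GrassmannOne F) :=
  Submodule.span F
    {a : GrassmannOne F | ∃ l : List ℕ, P l.length ∧ (l.map (gen F)).prod = a}

variable {F} in
theorem lengthSpan_mul_mem {P Q R : ℕ → Prop} (h : ∀ m n, P m → Q n → R (m + n))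
    {a b : GrassmannOne F} (ha : a ∈ lengthSpan F P) (hb : b ∈ lengthSpan F Q) :
    a * b ∈ lengthSpan F R := by
  have hab : a * b ∈ lengthSpan F P * lengthSpan F Q := Submodule.mul_mem_mul ha hb
  unfold lengthSpan at hab
  rw [Submodule.span_mul_span] at hab
  refine Submodule.span_mono ?_ hab
  rintro _ ⟨_, ⟨l, hl, rfl⟩, _, ⟨k, hk, rfl⟩, rfl⟩
  exact ⟨l ++ k, by rw [List.length_append]; exact h _ _ hl hk, by simp⟩

/-- The 2 × 2 matrices with diagonal entries in `A₀` and off-diagonal entries in `A₁`, as an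
associative algebra (possibly without identity). -/
def superMatrix {A : Type*} [Ring A] [Algebra F A] (A₀ A₁ : Submodule F A)
    (h₀₀ : ∀ a ∈ A₀, ∀ b ∈ A₀, a * b ∈ A₀) (h₀₁ : ∀ a ∈ A₀, ∀ b ∈ A₁, a * b ∈ A₁)
    (h₁₀ : ∀ a ∈ A₁, ∀ b ∈ A₀, a * b ∈ A₁) (h₁₁ : ∀ a ∈ A₁, ∀ b ∈ A₁, a * b ∈ A₀) :
    NonUnitalSubalgebra F (Matrix (Fin 2) (Fin 2) A) where
  carrier := {M | (M 0 0 ∈ A₀ ∧ M 1 1 ∈ A₀) ∧ M 0 1 ∈ A₁ ∧ M 1 0 ∈ A₁}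
  zero_mem' := by simp
  add_mem' := by
    rintro M N ⟨⟨h1, h2⟩, h3, h4⟩ ⟨⟨k1, k2⟩, k3, k4⟩
    exact ⟨⟨A₀.add_mem h1 k1, A₀.add_mem h2 k2⟩, A₁.add_mem h3 k3, A₁.add_mem h4 k4⟩
  smul_mem' := by
    rintro c M ⟨⟨h1, h2⟩, h3, h4⟩
    exact ⟨⟨A₀.smul_mem c h1, A₀.smul_mem c h2⟩, A₁.smul_mem c h3, A₁.smul_mem c h4⟩
  mul_mem' := by
    rintro M N ⟨⟨h1, h2⟩, h3, h4⟩ ⟨⟨k1, k2⟩, k3, k4⟩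
    simp only [Set.mem_ofPred_eq, Matrix.mul_apply, Fin.sum_univ_two]
    exact ⟨⟨A₀.add_mem (h₀₀ _ h1 _ k1) (h₁₁ _ h3 _ k4),
      A₀.add_mem (h₁₁ _ h4 _ k3) (h₀₀ _ h2 _ k2)⟩,
      A₁.add_mem (h₀₁ _ h1 _ k3) (h₁₀ _ h3 _ k2),
      A₁.add_mem (h₁₀ _ h4 _ k1) (h₀₁ _ h2 _ k4)⟩

/-- `E₁`: the span of the products of generators of odd length. -/
noncomputable def oddPart : Submodule F (GrassmannOne F) := lengthSpan F Odd

/-- `E₀`: the span of the products of generators of even positive length. -/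
noncomputable def evenPart : Submodule F (GrassmannOne F) :=
  lengthSpan F (fun n => Even n ∧ 0 < n)

/-- `E₀¹`: the span of the products of generators of even length, including `1`. -/
noncomputable def evenPartOne : Submodule F (GrassmannOne F) := lengthSpan F Even

/-- The associative algebra `M₁,₁(E)`, where `E` is the Grassmann algebra without identity. -/
noncomputable def M11E : NonUnitalSubalgebra F (Matrix (Fin 2) (Fin 2) (GrassmannOne F)) :=
  superMatrix F (evenPart F) (oddPart F)
    (fun _ ha _ hb => lengthSpan_mul_mem (fun _ _ hm hn => ⟨hm.1.add hn.1, by omega⟩) ha hb)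
    (fun _ ha _ hb => lengthSpan_mul_mem (fun _ _ hm hn => hm.1.add_odd hn) ha hb)
    (fun _ ha _ hb => lengthSpan_mul_mem (fun _ _ hm hn => hm.add_even hn.1) ha hb)
    (fun _ ha _ hb => lengthSpan_mul_mem
      (fun _ _ hm hn => ⟨hm.add_odd hn, Nat.add_pos_left hm.pos _⟩) ha hb)

/-- The associative algebra `M₁,₁(E¹)`, where `E¹` is the Grassmann algebra with identity. -/
noncomputable def M11EOne : NonUnitalSubalgebra F (Matrix (Fin 2) (Fin 2) (GrassmannOne F)) :=
  superMatrix F (evenPartOne F) (oddPart F)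
    (fun _ ha _ hb => lengthSpan_mul_mem (fun _ _ hm hn => hm.add hn) ha hb)
    (fun _ ha _ hb => lengthSpan_mul_mem (fun _ _ hm hn => hm.add_odd hn) ha hb)
    (fun _ ha _ hb => lengthSpan_mul_mem (fun _ _ hm hn => hm.add_even hn) ha hb)
    (fun _ ha _ hb => lengthSpan_mul_mem (fun _ _ hm hn => hm.add_odd hn) ha hb)

end Grassmann

/-! ### Adjoint Lie algebras -/

attribute [local instance] LieRing.ofAssociativeRing

/-- The adjoint Lie algebra of an associative algebra `B` (given as a subalgebra, possibly without
identity, of `A`): the same elements with the bracket `[a, b] = a * b - b * a`. -/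
def adjointLie {F A : Type*} [Field F] [Ring A] [Algebra F A] (B : NonUnitalSubalgebra F A) :
    LieSubalgebra F A :=
  { B.toSubmodule with
    lie_mem' := fun {x y} hx hy => by
      rw [LieRing.of_associative_ring_bracket]
      exact B.toSubmodule.sub_mem (B.mul_mem hx hy) (B.mul_mem hy hx) }

end LiePI

/-! The matrix algebras enter only through a four-dimensional Lie algebra, the diamond algebra with
`[b, d] = s`, `[t, b] = b`, `[t, d] = -d`. It embeds in `M₁,₁(E¹)` by sending `b`, `d` to
off-diagonal matrices with entries `e₀`, `e₁`. Multiplying the value of the `m`-th variable by its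
own central product of two generators moves the substitution into `M₁,₁(E)`. On a multilinear `f`
these factors come out as one common nonzero multiplier, so `f` is an identity of the diamond
algebra (`isIdentity_diamond`).

It remains to see that the diamond algebra detects every multilinear element of the relatively free
centre-by-metabelian algebra (`isConsequence_of_diamond`). For a set of `n ≥ 2` variables, the
multilinear part there is spanned by the monomials `[x_i, x_o, …]`, with `o` fixed, and `w(i,j,k,l)
= [[x_i, x_j], [x_k, x_l, …]]`. Evaluate at `x_i ↦ t + x_i b + y_i d`. The `b`-coordinate shows that
the coefficients of the first kind vanish; the `s`-coordinate gives a bilinear relation between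
those of the second kind.

This relation suffices because `w` has a potential: `w(i,j,k,l) = φ(j,l) - φ(j,k) - φ(i,l) +
φ(i,k)`, where `φ(q,p) = e φ(p,q)` and `e = -(-1)^n`. This follows from formal properties of `w`
alone (`IsPairCocycle`) when 2 is invertible. A combination of the `w` is then `∑ M(p,r) φ(p,r)`,
and the relation says `M(p,r) = -e M(r,p)`, so twice the sum is zero (`sum_pairMonomial_eq_zero`).
-/

namespace LiePI

/-! ### Cocycles on pairs of disjoint pairs of points -/

section PairCocycle

variable {F A α : Type*} [Field F] [AddCommGroup A] [Module F A]

/-- A function of two disjoint ordered pairs of points, skew-symmetric in each of the pairs,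
multiplied by `e` when the pairs are interchanged, and additive along paths in the second pair. -/
structure IsPairCocycle (e : F) (w : α → α → α → α → A) : Prop where
  skew_left : ∀ i j k l, w j i k l = -w i j k l
  skew_right : ∀ i j k l, w i j l k = -w i j k l
  swap : ∀ i j k l, [i, j, k, l].Nodup → w k l i j = e • w i j k l
  cocycle : ∀ i j k l m, [i, j, k, l, m].Nodup → w i j k l + w i j l m + w i j m k = 0

namespace IsPairCocycle

variable {e : F} {w : α → α → α → α → A}

theorem path_right (h : IsPairCocycle e w) {i j k l m : α} (hd : [i, j, k, l, m].Nodup) :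
    w i j k m - w i j k l = w i j l m := by
  have h1 := h.cocycle i j k l m hd
  have h2 := h.skew_right i j k m
  rw [h2] at h1
  rw [← sub_eq_zero, ← neg_eq_zero, ← h1]
  abel

theorem path_left (h : IsPairCocycle e w) (he : e * e = 1) {i j k l m : α}
    (hd : [i, j, k, l, m].Nodup) : w i k l m - w i j l m = w j k l m := by
  have h1 := h.path_right (i := l) (j := m) (k := i) (l := j) (m := k) (by simp at hd ⊢; grind)
  have hs : ∀ p q, [p, q, l, m].Nodup → w p q l m = e • w l m p q := by
    intro p q hpq
    rw [h.swap p q l m hpq, smul_smul, he, one_smul]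
  rw [hs i k (by simp at hd ⊢; grind), hs i j (by simp at hd ⊢; grind),
    hs j k (by simp at hd ⊢; grind), ← h1, smul_sub]

/-- The first Bianchi identity. -/
theorem bianchi (h : IsPairCocycle (1 : F) w) (h2 : (2 : F) ≠ 0) {i j k l m : α}
    (hd : [i, j, k, l, m].Nodup) : w i j k l + w j k i l + w k i j l = 0 := by
  -- The cyclic sum does not depend on its fourth point: after interchanging the pairs, the
  -- difference is a cocycle sum around the triangle `i, j, k` with the pair `m, l` fixed.
  have key : ∀ i j k l m : α, [i, j, k, l, m].Nodup →
      w i j k l + w j k i l + w k i j l = w i j k m + w j k i m + w k i j m := by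
    intro i j k l m hd
    have e1 := h.path_right (i := i) (j := j) (k := k) (l := m) (m := l)
      (by simp at hd ⊢; grind)
    have e2 := h.path_right (i := j) (j := k) (k := i) (l := m) (m := l)
      (by simp at hd ⊢; grind)
    have e3 := h.path_right (i := k) (j := i) (k := j) (l := m) (m := l)
      (by simp at hd ⊢; grind)
    have hs : ∀ p q, [p, q, m, l].Nodup → w p q m l = w m l p q := by
      intro p q hpq
      rw [h.swap p q m l hpq, one_smul]
    have e4 := h.cocycle m l i j k (by simp at hd ⊢; grind)
    rw [hs _ _ (by simp at hd ⊢; grind)] at e1 e2 e3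
    have : w i j k l + w j k i l + w k i j l - (w i j k m + w j k i m + w k i j m)
        = w m l i j + w m l j k + w m l k i := by
      rw [← e1, ← e2, ← e3]; abel
    rw [e4] at this
    exact sub_eq_zero.mp this
  have sw : ∀ i j k l : α, [i, j, k, l].Nodup →
      w i j l k + w j l i k + w l i j k = -(w i j k l + w j k i l + w k i j l) := by
    intro i j k l hd
    have e1 := h.skew_right i j k l
    have e2 := h.swap i k j l (by simp at hd ⊢; grind)
    have e3 := h.swap j k l i (by simp at hd ⊢; grind)
    have e4 := h.skew_left i k j l
    have e5 := h.skew_right j k i l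
    rw [one_smul] at e2 e3
    rw [e1, e2, e3, e4, e5]; abel
  -- The fifth point serves as a vacant seat. Alternating `key` with the sign-changing exchange `sw`
  -- returns to the original sum after three exchanges, hence `b = -b`.
  have k1 := key i j k l m hd
  have k2 := sw i j k m (by simp at hd ⊢; grind)
  have k3 := key i j m k l (by simp at hd ⊢; grind)
  have k4 := sw i j m l (by simp at hd ⊢; grind)
  have k5 := key i j l m k (by simp at hd ⊢; grind)
  have k6 := sw i j k l (by simp at hd ⊢; grind)
  set b := w i j k l + w j k i l + w k i j l
  have hb : b = -b := by
    rw [← k6, ← k5, k4, ← k3, k2, ← k1, neg_neg]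
  have : (2 : F) • b = 0 := by rw [two_smul]; nth_rw 2 [hb]; abel
  exact (smul_eq_zero.mp this).resolve_left h2

/-- A potential that is correct on the pairs through a base point is correct everywhere. -/
theorem eq_coboundary_of_base (h : IsPairCocycle e w) (he : e * e = 1) {φ : α → α → A} (o : α)
    (hφ : ∀ p q, φ q p = e • φ p q) (h0 : ∀ q, φ o q = 0)
    (hb : ∀ j k l, [o, j, k, l].Nodup → w o j k l = φ j l - φ j k)
    (i j k l : α) (hd : [i, j, k, l].Nodup) :
    w i j k l = φ j l - φ j k - φ i l + φ i k := by
  have h0' : ∀ q, φ q o = 0 := fun q => by rw [hφ o q, h0, smul_zero]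
  have left : ∀ i j k l, [i, j, k, l].Nodup → i = o →
      w i j k l = φ j l - φ j k - φ i l + φ i k := by
    rintro i j k l hd rfl
    rw [hb j k l hd, h0, h0]; abel
  have pair : ∀ i j k l, [i, j, k, l].Nodup → (i = o ∨ j = o) →
      w i j k l = φ j l - φ j k - φ i l + φ i k := by
    rintro i j k l hd (rfl | rfl)
    · exact left _ _ _ _ hd rfl
    · rw [h.skew_left j i, left j i k l (by simp at hd ⊢; grind) rfl]; abel
  by_cases hij : i = o ∨ j = o
  · exact pair i j k l hd hij
  by_cases hkl : k = o ∨ l = o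
  · rw [h.swap k l i j (by simp at hd ⊢; grind), pair k l i j (by simp at hd ⊢; grind) hkl,
      hφ l j, hφ k j, hφ l i, hφ k i]
    have hφ' : ∀ p q, e • φ q p = φ p q := fun p q => (hφ q p).symm
    simp only [smul_add, smul_sub, hφ']
    abel
  -- With `o` in neither pair, the path from `i` to `j` is routed through `o`.
  push Not at hij hkl
  have e1 := h.path_left he (i := o) (j := i) (k := j) (l := k) (m := l)
    (by simp at hd ⊢; grind)
  rw [← e1, hb j k l (by simp at hd ⊢; grind), hb i k l (by simp at hd ⊢; grind)]
  abel

open Classical in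
-- If a skew potential with `φ(o, ·) = 0` exists, then `w(o,j,k,l) + w(o,l,j,k) + w(o,k,j,l) = 2
-- φ(j,l)` for any further point `k`. So half of the left side is taken as the definition, once it
-- is known not to depend on `k`.
theorem exists_potential_neg (h : IsPairCocycle (-1 : F) w) (h2 : (2 : F) ≠ 0) (o : α)
    (h4 : ∀ a b c : α, ∃ d, d ≠ a ∧ d ≠ b ∧ d ≠ c) :
    ∃ φ : α → α → A, (∀ p q, φ q p = (-1 : F) • φ p q) ∧
      ∀ i j k l, [i, j, k, l].Nodup → w i j k l = φ j l - φ j k - φ i l + φ i k := by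
  have he : (-1 : F) * (-1) = 1 := by ring
  obtain ⟨c, hc⟩ : ∃ c : F, c + c = 1 := ⟨2⁻¹, by field_simp; norm_num⟩
  let T : α → α → α → A := fun j l k => w o j k l + w o l j k + w o k j l
  have hT : ∀ j l k m, [o, j, l, k].Nodup → [o, j, l, m].Nodup → T j l k = T j l m := by
    intro j l k m hk hm
    by_cases hkm : k = m
    · rw [hkm]
    have e1 := h.path_right (i := o) (j := j) (k := l) (l := m) (m := k)
      (by simp at hk hm ⊢; grind)
    have e2 := h.path_right (i := o) (j := l) (k := j) (l := m) (m := k)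
      (by simp at hk hm ⊢; grind)
    have e3 := h.path_left he (i := o) (j := m) (k := k) (l := j) (m := l)
      (by simp at hk hm ⊢; grind)
    have e4 := h.path_left he (i := o) (j := j) (k := l) (l := m) (m := k)
      (by simp at hk hm ⊢; grind)
    have e5 := h.swap j l m k (by simp at hk hm ⊢; grind)
    have e6 := h.skew_right o j l k
    have e7 := h.skew_right o j l m
    have : T j l k - T j l m = 0 := by
      simp only [T]
      rw [e6, e7]
      calc _ = -(w o j l k - w o j l m) + (w o l j k - w o l j m) +
            (w o k j l - w o m j l) := by abel
        _ = 0 := by rw [e1, e2, e3, e5, ← e4, neg_one_smul]; abel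
    exact sub_eq_zero.mp this
  have hTs : ∀ j l k, T l j k = -T j l k := by
    intro j l k
    simp only [T]
    rw [h.skew_right o l j k, h.skew_right o j k l, h.skew_right o k j l]
    abel
  choose d hd using fun j l => h4 o j l
  let φ : α → α → A := fun j l => if j = o ∨ l = o ∨ j = l then 0 else c • T j l (d j l)
  have hφT : ∀ j l k, [o, j, l, k].Nodup → φ j l = c • T j l k := by
    intro j l k hn
    have hdj := hd j l
    have : ¬ (j = o ∨ l = o ∨ j = l) := by simp at hn ⊢; grind
    simp only [φ, if_neg this]
    rw [hT j l (d j l) k (by simp at hn ⊢; grind) hn]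
  have hφ : ∀ p q, φ q p = (-1 : F) • φ p q := by
    intro p q
    by_cases hpq : p = o ∨ q = o ∨ p = q
    · have : q = o ∨ p = o ∨ q = p := by grind
      simp only [φ, if_pos hpq, if_pos this, smul_zero]
    · have hdj := hd p q
      rw [hφT p q (d p q) (by simp; grind), hφT q p (d p q) (by simp; grind), hTs, neg_one_smul,
        smul_neg]
  refine ⟨φ, hφ, h.eq_coboundary_of_base he o hφ (fun q => by simp [φ]) ?_⟩
  intro j k l hn
  rw [hφT j l k (by simp at hn ⊢; grind), hφT j k l (by simp at hn ⊢; grind), ← smul_sub]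
  simp only [T]
  rw [h.skew_right o j k l]
  calc w o j k l = (c + c) • w o j k l := by rw [hc, one_smul]
    _ = c • (w o j k l + w o j k l) := by rw [add_smul, smul_add]
    _ = _ := by congr 1; abel

open Classical in
-- A symmetric potential is normalised by `φ(o, ·) = 0` and `φ(a, b) = 0`. This forces `φ(a, j) =
-- w(o,a,b,j)` and then `φ(j, l) = φ(j, a) + w(o,j,a,l)`. That the result is symmetric is the
-- Bianchi identity, which is why five points are required.
theorem exists_potential_one (h : IsPairCocycle (1 : F) w) (h2 : (2 : F) ≠ 0)
    {o a b : α} (hoab : [o, a, b].Nodup)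
    (h5 : ∀ a b c d : α, ∃ m, m ≠ a ∧ m ≠ b ∧ m ≠ c ∧ m ≠ d) :
    ∃ φ : α → α → A, (∀ p q, φ q p = (1 : F) • φ p q) ∧
      ∀ i j k l, [i, j, k, l].Nodup → w i j k l = φ j l - φ j k - φ i l + φ i k := by
  have he : (1 : F) * 1 = 1 := by ring
  let u : α → A := fun j => if j = b then 0 else w o a b j
  have hu : ∀ k l, [o, a, k, l].Nodup → w o a k l = u l - u k := by
    intro k l hn
    by_cases hk : k = b
    · subst hk
      have : l ≠ k := by simp at hn; grind
      simp [u, this]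
    by_cases hl : l = b
    · subst hl
      simp [u, hk, h.skew_right o a k l]
    simp only [u, if_neg hk, if_neg hl]
    rw [h.path_right (by simp at hn hoab ⊢; grind)]
  let φ : α → α → A := fun j l => if j = o ∨ l = o ∨ j = l then 0 else
    if j = a then u l else if l = a then u j else u j + w o j a l
  have hφ' : ∀ p q, φ q p = φ p q := by
    intro p q
    by_cases hpq : p = o ∨ q = o ∨ p = q
    · have : q = o ∨ p = o ∨ q = p := by grind
      simp only [φ, if_pos hpq, if_pos this]
    have hqp : ¬ (q = o ∨ p = o ∨ q = p) := by grind
    simp only [φ, if_neg hpq, if_neg hqp]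
    by_cases hp : p = a
    · have : q ≠ a := by grind
      simp [hp, this]
    by_cases hq : q = a
    · simp [hp, hq]
    simp only [hp, hq, if_false]
    obtain ⟨m, hm⟩ := h5 o a p q
    have hB := h.bianchi h2 (i := o) (j := p) (k := a) (l := q) (m := m)
      (by simp at hoab ⊢; grind)
    have e1 := hu q p (by simp at hoab ⊢; grind)
    have e2 := h.swap o q p a (by simp at hoab ⊢; grind)
    have e3 := h.skew_right o q p a
    have e4 := h.skew_left o a p q
    have e5 := h.skew_right o a q p
    rw [one_smul] at e2
    rw [e2, e4, e5, e1, ← neg_eq_iff_eq_neg.mpr e3] at hB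
    rw [← sub_eq_zero, ← neg_eq_zero, ← hB]
    abel
  have hφ : ∀ p q, φ q p = (1 : F) • φ p q := fun p q => by rw [one_smul, hφ']
  refine ⟨φ, hφ, h.eq_coboundary_of_base he o hφ (fun q => by simp [φ]) ?_⟩
  intro j k l hn
  have hjl : ¬ (j = o ∨ l = o ∨ j = l) := by simp at hn; grind
  have hjk : ¬ (j = o ∨ k = o ∨ j = k) := by simp at hn; grind
  simp only [φ, if_neg hjl, if_neg hjk]
  by_cases hj : j = a
  · subst hj
    simp [hu k l hn]
  by_cases hk : k = a
  · subst hk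
    have : l ≠ k := by simp at hn; grind
    simp [hj, this]
  by_cases hl : l = a
  · subst hl
    simp [hj, hk, h.skew_right o j k l]
  simp only [hj, hk, hl, if_false]
  rw [← h.path_right (i := o) (j := j) (k := a) (l := k) (m := l) (by simp at hn hoab ⊢; grind)]
  abel

end IsPairCocycle

end PairCocycle

end LiePI

namespace LiePI

/-! ### Left-normed brackets in centre-by-metabelian Lie algebras -/

section LeftNormed

variable {Q : Type*} [LieRing Q]

/-- The left-normed bracket `[u, x_{r₁}, …, x_{rₙ}]`. -/
def leftNormed (X : ℕ → Q) (u : Q) (l : List ℕ) : Q :=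
  l.foldl (fun v r => ⁅v, X r⁆) u

variable (X : ℕ → Q)

@[simp] theorem leftNormed_nil (u : Q) : leftNormed X u [] = u := rfl

@[simp] theorem leftNormed_cons (u : Q) (r : ℕ) (l : List ℕ) :
    leftNormed X u (r :: l) = leftNormed X ⁅u, X r⁆ l := rfl

theorem leftNormed_append (u : Q) (l l' : List ℕ) :
    leftNormed X u (l ++ l') = leftNormed X (leftNormed X u l) l' := by
  simp [leftNormed]

theorem leftNormed_sub (u v : Q) (l : List ℕ) :
    leftNormed X (u - v) l = leftNormed X u l - leftNormed X v l := by
  induction l generalizing u v with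
  | nil => rfl
  | cons r l ih => simp [sub_lie, ih]

theorem leftNormed_zero (l : List ℕ) : leftNormed X 0 l = 0 := by
  simpa using leftNormed_sub X 0 0 l

theorem leftNormed_neg (u : Q) (l : List ℕ) : leftNormed X (-u) l = -leftNormed X u l := by
  simpa [leftNormed_zero] using leftNormed_sub X 0 u l

theorem leftNormed_skew (i j : ℕ) (l : List ℕ) :
    leftNormed X ⁅X j, X i⁆ l = -leftNormed X ⁅X i, X j⁆ l := by
  rw [← leftNormed_neg, lie_skew]

theorem lie_lie_right (u v x : Q) : ⁅⁅u, v⁆, x⁆ = ⁅⁅u, x⁆, v⁆ + ⁅u, ⁅v, x⁆⁆ := by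
  rw [lie_lie u v x, ← lie_skew ⁅u, x⁆ v]
  abel

theorem leftNormed_jacobi (u v x : Q) (l : List ℕ) :
    leftNormed X ⁅⁅u, v⁆, x⁆ l = leftNormed X ⁅⁅u, x⁆, v⁆ l - leftNormed X ⁅⁅v, x⁆, u⁆ l := by
  rw [← leftNormed_sub, lie_lie_right u v x, ← lie_skew ⁅v, x⁆ u, sub_neg_eq_add]

theorem map_leftNormed {F P : Type*} [CommRing F] [LieRing P] [LieAlgebra F Q] [LieAlgebra F P]
    (g : Q →ₗ⁅F⁆ P) (u : Q) (l : List ℕ) :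
    g (leftNormed X u l) = leftNormed (fun i => g (X i)) (g u) l := by
  induction l generalizing u with
  | nil => rfl
  | cons r l ih => simp [ih, LieHom.map_lie]

theorem exists_leftNormed_eq_lie (a b : Q) (l : List ℕ) :
    ∃ c d : Q, leftNormed X ⁅a, b⁆ l = ⁅c, d⁆ := by
  induction l generalizing a b with
  | nil => exact ⟨a, b, rfl⟩
  | cons r l ih => exact ih ⁅a, b⁆ (X r)

variable (Q) in
/-- The law `[[[x, y], [z, t]], u] = 0`. -/
def IsCentreByMetabelian : Prop := ∀ x y z t u : Q, ⁅⁅⁅x, y⁆, ⁅z, t⁆⁆, u⁆ = 0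

namespace IsCentreByMetabelian

variable {X}
variable (hQ : IsCentreByMetabelian Q)
include hQ

theorem leftNormed_eq_zero (a b c d : Q) {l : List ℕ} (hl : l ≠ []) :
    leftNormed X ⁅⁅a, b⁆, ⁅c, d⁆⁆ l = 0 := by
  cases l with
  | nil => exact absurd rfl hl
  | cons r l => rw [leftNormed_cons, hQ, leftNormed_zero]

/-- The element `[[a, b], [c, d]]` is central, so the derivation given by bracketing with `x` kills
it. -/
theorem lie_swap (a b c d x : Q) : ⁅⁅⁅a, b⁆, x⁆, ⁅c, d⁆⁆ = -⁅⁅a, b⁆, ⁅⁅c, d⁆, x⁆⁆ := by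
  have h := hQ a b c d x
  rw [lie_lie_right] at h
  exact eq_neg_of_add_eq_zero_left h

theorem leftNormed_adjoint (a b c d : Q) (l : List ℕ) :
    ⁅leftNormed X ⁅a, b⁆ l, ⁅c, d⁆⁆ =
      (-1 : ℤ) ^ l.length • ⁅⁅a, b⁆, leftNormed X ⁅c, d⁆ l.reverse⁆ := by
  induction l generalizing a b with
  | nil => simp
  | cons r l ih =>
    obtain ⟨p, q, hpq⟩ := exists_leftNormed_eq_lie X c d l.reverse
    rw [leftNormed_cons, ih, List.reverse_cons, leftNormed_append, hpq, hQ.lie_swap,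
      List.length_cons, pow_succ, leftNormed_cons, leftNormed_nil, mul_neg_one, neg_smul, smul_neg]

/-- Exchanging two adjacent letters of the tail costs a bracket of two commutators with the later
letters applied. It is central, and the outer bracket annihilates it. -/
theorem leftNormed_perm {l l' : List ℕ} (h : l.Perm l') (a b c d : Q) :
    ⁅⁅a, b⁆, leftNormed X ⁅c, d⁆ l⁆ = ⁅⁅a, b⁆, leftNormed X ⁅c, d⁆ l'⁆ := by
  induction h generalizing c d with
  | nil => rfl
  | cons x _ ih => exact ih _ _
  | swap x y l =>
    simp only [leftNormed_cons]
    rw [← sub_eq_zero, ← lie_sub, ← leftNormed_sub]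
    have : ⁅⁅⁅c, d⁆, X y⁆, X x⁆ - ⁅⁅⁅c, d⁆, X x⁆, X y⁆ = ⁅⁅c, d⁆, ⁅X y, X x⁆⁆ := by
      rw [lie_lie_right ⁅c, d⁆ (X y), add_sub_cancel_left]
    rw [this]
    rcases l with _ | ⟨r, l⟩
    · rw [leftNormed_nil, ← lie_skew, hQ, neg_zero]
    · rw [hQ.leftNormed_eq_zero _ _ _ _ (by simp), lie_zero]
  | trans _ _ ih1 ih2 => rw [ih1, ih2]

end IsCentreByMetabelian

end LeftNormed

end LiePI

namespace LiePI

/-! ### Normal monomials spanning the multilinear part -/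

section Span

/-- The multiset of letters of a bracketed word. -/
def letters : FreeMagma ℕ → Multiset ℕ
  | FreeMagma.of i => {i}
  | FreeMagma.mul v w => letters v + letters w

theorem count_letters (i : ℕ) (w : FreeMagma ℕ) : (letters w).count i = wordDegree i w := by
  induction w with
  | ih1 j => simp [letters, wordDegree, Multiset.count_singleton, eq_comm]
  | ih2 v w hv hw => exact (Multiset.count_add _ _ _).trans (congrArg₂ (· + ·) hv hw)

theorem letters_eq_val {s : Finset ℕ} {w : FreeMagma ℕ}
    (h : ∀ i, wordDegree i w = if i ∈ s then 1 else 0) : letters w = s.val := by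
  ext i
  rw [count_letters, h, Multiset.count_eq_of_nodup s.nodup]
  simp

variable (F : Type*) {Q : Type*} [Field F] [LieRing Q] [LieAlgebra F Q] (X : ℕ → Q)

/-- The left-normed monomials with a given multiset of letters. -/
def leftNormedSet (m : Multiset ℕ) : Set Q :=
  {v | ∃ i j l, ((i :: j :: l : List ℕ) : Multiset ℕ) = m ∧ leftNormed X ⁅X i, X j⁆ l = v}

/-- The monomials `[[x_i, x_j], [x_k, x_l, …]]` with a given multiset of letters. -/
def pairSet (m : Multiset ℕ) : Set Q :=
  {v | ∃ i j k l r, ((i :: j :: k :: l :: r : List ℕ) : Multiset ℕ) = m ∧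
    ⁅⁅X i, X j⁆, leftNormed X ⁅X k, X l⁆ r⁆ = v}

/-- The span of the normal monomials with a given multiset of letters. -/
def monomialSpan (m : Multiset ℕ) : Submodule F Q :=
  Submodule.span F (leftNormedSet X m ∪ pairSet X m)

variable {X} (hQ : IsCentreByMetabelian Q)

theorem mem_monomialSpan_of_pairSet {m : Multiset ℕ} {v : Q} (h : v ∈ pairSet X m) :
    v ∈ monomialSpan F X m := Submodule.subset_span (Or.inr h)

theorem mem_monomialSpan_of_leftNormedSet {m : Multiset ℕ} {v : Q} (h : v ∈ leftNormedSet X m) :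
    v ∈ monomialSpan F X m := Submodule.subset_span (Or.inl h)

include hQ

theorem pairSet_central {m : Multiset ℕ} {u : Q} (hu : u ∈ pairSet X m) (v : Q) : ⁅u, v⁆ = 0 := by
  obtain ⟨i, j, k, l, r, -, rfl⟩ := hu
  obtain ⟨c, d, hcd⟩ := exists_leftNormed_eq_lie X (X k) (X l) r
  rw [hcd, hQ]

theorem lie_letter_mem {m : Multiset ℕ} {u : Q} (hu : u ∈ monomialSpan F X m) (r : ℕ) :
    ⁅u, X r⁆ ∈ monomialSpan F X (m + {r}) := by
  induction hu using Submodule.span_induction with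
  | mem u hu =>
    rcases hu with ⟨i, j, l, rfl, rfl⟩ | hu
    · refine mem_monomialSpan_of_leftNormedSet F ⟨i, j, l ++ [r], ?_, ?_⟩
      · rw [← Multiset.coe_singleton, Multiset.coe_add]; rfl
      · rw [leftNormed_append]; rfl
    · rw [pairSet_central hQ hu]; exact Submodule.zero_mem _
  | zero => rw [zero_lie]; exact Submodule.zero_mem _
  | add u v _ _ hu hv => rw [add_lie]; exact Submodule.add_mem _ hu hv
  | smul c u _ hu => rw [smul_lie]; exact Submodule.smul_mem _ _ hu

theorem leftNormed_lie_leftNormed (i j k l : ℕ) (r t : List ℕ) :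
    ⁅leftNormed X ⁅X i, X j⁆ r, leftNormed X ⁅X k, X l⁆ t⁆ =
      (-1 : ℤ) ^ r.length • ⁅⁅X i, X j⁆, leftNormed X ⁅X k, X l⁆ (t ++ r.reverse)⁆ := by
  obtain ⟨c, d, hcd⟩ := exists_leftNormed_eq_lie X (X k) (X l) t
  rw [leftNormed_append, hcd, hQ.leftNormed_adjoint]

theorem lie_mem_monomialSpan {m n : Multiset ℕ} {u v : Q} (hu : u ∈ monomialSpan F X m)
    (hv : v ∈ monomialSpan F X n) : ⁅u, v⁆ ∈ monomialSpan F X (m + n) := by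
  refine LinearMap.BilinMap.apply_apply_mem_of_mem_span (R := F) (monomialSpan F X (m + n)) _ _
    (LieModule.toEnd F Q Q : Q →ₗ[F] Q →ₗ[F] Q) ?_ u v hu hv
  rintro u hu v hv
  change ⁅u, v⁆ ∈ _
  rcases hu with ⟨i, j, r, rfl, rfl⟩ | hu
  · rcases hv with ⟨k, l, t, rfl, rfl⟩ | hv
    · rw [leftNormed_lie_leftNormed hQ, ← Int.cast_smul_eq_zsmul F]
      refine Submodule.smul_mem _ _ (mem_monomialSpan_of_pairSet F ⟨i, j, k, l, _, ?_, rfl⟩)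
      rw [Multiset.coe_add, Multiset.coe_eq_coe]
      simp only [List.perm_iff_count, List.count_append, List.count_cons, List.count_reverse]
      intro a
      omega
    · rw [← lie_skew, pairSet_central hQ hv, neg_zero]; exact Submodule.zero_mem _
  · rw [pairSet_central hQ hu]; exact Submodule.zero_mem _

theorem lift_lieMonomial_mem (w : FreeMagma ℕ) : (∃ i, w = FreeMagma.of i) ∨
    FreeLieAlgebra.lift F X (lieMonomial F w) ∈ monomialSpan F X (letters w) := by
  induction w with
  | ih1 i => exact Or.inl ⟨i, rfl⟩
  | ih2 v w hv hw =>
    right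
    change FreeLieAlgebra.lift F X ⁅lieMonomial F v, lieMonomial F w⁆ ∈
      monomialSpan F X (letters v + letters w)
    rw [LieHom.map_lie]
    rcases hv with ⟨i, rfl⟩ | hv <;> rcases hw with ⟨j, rfl⟩ | hw
    · simp only [lieMonomial, FreeLieAlgebra.lift_of_apply, letters]
      exact mem_monomialSpan_of_leftNormedSet F ⟨i, j, [], rfl, rfl⟩
    · simp only [lieMonomial, FreeLieAlgebra.lift_of_apply]
      rw [← lie_skew, add_comm]
      exact Submodule.neg_mem _ (lie_letter_mem F hQ hw i)
    · simp only [lieMonomial, FreeLieAlgebra.lift_of_apply]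
      exact lie_letter_mem F hQ hv j
    · exact lie_mem_monomialSpan F hQ hv hw

/-! ### Multilinear monomials -/

omit hQ in
theorem perm_toList_sdiff {s : Finset ℕ} {p l : List ℕ}
    (h : ((p ++ l : List ℕ) : Multiset ℕ) = s.val) : l.Perm (s \ p.toFinset).toList := by
  have hn : (p ++ l).Nodup := by
    rw [← Multiset.coe_nodup, h]; exact s.nodup
  have hm : ∀ a, a ∈ s ↔ a ∈ p ++ l := fun a => by
    rw [← Finset.mem_val, ← h, Multiset.mem_coe]
  rw [List.nodup_append] at hn
  rw [List.perm_ext_iff_of_nodup hn.2.1 (Finset.nodup_toList _)]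
  intro a
  simp only [Finset.mem_toList, Finset.mem_sdiff, hm, List.mem_append, List.mem_toFinset]
  constructor
  · exact fun ha => ⟨Or.inr ha, fun hp => hn.2.2 a hp a ha rfl⟩
  · rintro ⟨h1 | h1, h2⟩
    · exact absurd h1 h2
    · exact h1

variable (X) in
/-- The monomial `[x_i, x_o, …]`, the other letters of `s` following. -/
noncomputable def basicMonomial (s : Finset ℕ) (o i : ℕ) : Q :=
  leftNormed X ⁅X i, X o⁆ (s \ [i, o].toFinset).toList

variable (X) in
/-- The monomial `[[x_i, x_j], [x_k, x_l, …]]`, the other letters of `s` following. -/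
noncomputable def pairMonomial (s : Finset ℕ) (i j k l : ℕ) : Q :=
  ⁅⁅X i, X j⁆, leftNormed X ⁅X k, X l⁆ (s \ [i, j, k, l].toFinset).toList⁆

/-- The quadruples of distinct elements of `s`. -/
def quadruples (s : Finset ℕ) : Finset (ℕ × ℕ × ℕ × ℕ) :=
  (s ×ˢ s ×ˢ s ×ˢ s).filter fun q => [q.1, q.2.1, q.2.2.1, q.2.2.2].Nodup

theorem pairSet_val (s : Finset ℕ) : pairSet X s.val ⊆
    (fun q : ℕ × ℕ × ℕ × ℕ => pairMonomial X s q.1 q.2.1 q.2.2.1 q.2.2.2) '' quadruples s := by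
  rintro _ ⟨i, j, k, l, r, h, rfl⟩
  have hn : (i :: j :: k :: l :: r).Nodup := by
    rw [← Multiset.coe_nodup, h]; exact s.nodup
  have hm : ∀ a, a ∈ s ↔ a ∈ i :: j :: k :: l :: r := fun a => by
    rw [← Finset.mem_val, ← h, Multiset.mem_coe]
  refine ⟨(i, j, k, l), ?_, ?_⟩
  · have : [i, j, k, l].Nodup := by
      have : (i :: j :: k :: l :: r) = [i, j, k, l] ++ r := rfl
      rw [this] at hn
      exact hn.of_append_left
    simp [quadruples, hm, -List.nodup_cons, this]
  · exact (hQ.leftNormed_perm (perm_toList_sdiff (p := [i, j, k, l]) h) _ _ _ _).symm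

/-- Here no outer bracket kills the cost of an exchange. The cost vanishes when a letter follows; at
the end of the word it is itself, up to sign, a monomial of `pairSet`. -/
theorem leftNormed_sub_mem {a b : ℕ} {l l' : List ℕ} (h : l.Perm l') {m : Multiset ℕ}
    (hm : ((a :: b :: l : List ℕ) : Multiset ℕ) = m) :
    leftNormed X ⁅X a, X b⁆ l - leftNormed X ⁅X a, X b⁆ l' ∈ Submodule.span F (pairSet X m) := by
  -- The prefix `p` records the letters already passed, which the error term of a final exchange
  -- still contains.
  suffices H : ∀ p : List ℕ, ((a :: b :: (p ++ l) : List ℕ) : Multiset ℕ) = m →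
      leftNormed X ⁅X a, X b⁆ (p ++ l) - leftNormed X ⁅X a, X b⁆ (p ++ l') ∈
        Submodule.span F (pairSet X m) from H [] hm
  clear hm
  induction h with
  | nil => intro p _; simp
  | @cons x l l' _ ih =>
    intro p hp
    simpa using ih (p ++ [x]) (by simpa using hp)
  | swap x y l =>
    intro p hp
    obtain ⟨c, d, hcd⟩ := exists_leftNormed_eq_lie X (X a) (X b) p
    simp only [leftNormed_append, leftNormed_cons]
    rw [← leftNormed_sub, hcd, lie_lie_right ⁅c, d⁆ (X y), add_sub_cancel_left]
    rcases l with _ | ⟨r, l⟩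
    · rw [leftNormed_nil, ← lie_skew, ← hcd]
      refine Submodule.neg_mem _ (Submodule.subset_span ⟨y, x, a, b, p, ?_, rfl⟩)
      rw [← hp, Multiset.coe_eq_coe]
      simp only [List.perm_iff_count, List.count_append, List.count_cons, List.count_nil]
      intro a
      omega
    · rw [hQ.leftNormed_eq_zero _ _ _ _ (by simp)]; exact Submodule.zero_mem _
  | @trans l₁ l₂ l₃ h12 _ ih1 ih2 =>
    intro p hp
    have := Submodule.add_mem _ (ih1 p hp) (ih2 p (by
      rw [← hp, Multiset.coe_eq_coe]
      exact ((h12.append_left p).cons b |>.cons a).symm))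
    simpa using this

/-- Modulo `pairSet` the letter `o` can be brought to third place, and the Jacobi identity `[i, j,
o] = [i, o, j] - [j, o, i]` then brings it to second place. -/
theorem leftNormed_basic_mem {s : Finset ℕ} {o i j : ℕ} (ho : o ∈ s) {l : List ℕ}
    (h : ((i :: j :: l : List ℕ) : Multiset ℕ) = s.val) :
    leftNormed X ⁅X i, X j⁆ l - (basicMonomial X s o i - basicMonomial X s o j) ∈
      Submodule.span F (pairSet X s.val) := by
  have base : ∀ i l, ((i :: o :: l : List ℕ) : Multiset ℕ) = s.val →
      leftNormed X ⁅X i, X o⁆ l - basicMonomial X s o i ∈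
        Submodule.span F (pairSet X s.val) := fun i l h =>
    leftNormed_sub_mem F hQ (perm_toList_sdiff (p := [i, o]) h) h
  have hoo : basicMonomial X s o o = 0 := by simp [basicMonomial, leftNormed_zero]
  by_cases hj : j = o
  · subst hj
    rw [hoo, sub_zero]
    exact base i l h
  by_cases hi : i = o
  · subst hi
    rw [hoo, zero_sub, sub_neg_eq_add, leftNormed_skew, neg_add_eq_sub, ← neg_sub]
    exact Submodule.neg_mem _ (base j l (by rw [← h, Multiset.coe_eq_coe]; exact .swap _ _ _))
  have hol : o ∈ l := by
    have : o ∈ i :: j :: l := by rw [← Multiset.mem_coe, h]; exact ho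
    simpa [Ne.symm hi, Ne.symm hj] using this
  have hp := List.perm_cons_erase hol
  have h1 := leftNormed_sub_mem F hQ (X := X) hp h
  rw [leftNormed_cons, leftNormed_jacobi] at h1
  have hc : ∀ a, (i :: j :: o :: l.erase o).count a = s.val.count a := fun a => by
    rw [← h, Multiset.coe_count]
    exact ((hp.cons j).cons i).symm.count_eq a
  have h2 := base i (j :: l.erase o) (by
    ext a
    rw [← hc, Multiset.coe_count]
    simp only [List.count_cons]
    omega)
  have h3 := base j (i :: l.erase o) (by
    ext a
    rw [← hc, Multiset.coe_count]
    simp only [List.count_cons]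
    omega)
  rw [leftNormed_cons] at h2 h3
  have := Submodule.sub_mem _ (Submodule.add_mem _ h1 h2) h3
  convert this using 1
  abel

theorem monomialSpan_val_le {s : Finset ℕ} {o : ℕ} (ho : o ∈ s) :
    monomialSpan F X s.val ≤ Submodule.span F (basicMonomial X s o '' s) ⊔
      Submodule.span F ((fun q : ℕ × ℕ × ℕ × ℕ =>
        pairMonomial X s q.1 q.2.1 q.2.2.1 q.2.2.2) '' quadruples s) := by
  have hpair := Submodule.span_mono (R := F) (pairSet_val hQ (X := X) s)
  refine Submodule.span_le.mpr (Set.union_subset ?_ ?_)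
  · rintro _ ⟨i, j, l, h, rfl⟩
    have hm : ∀ a, a ∈ s ↔ a ∈ i :: j :: l := fun a => by
      rw [← Finset.mem_val, ← h, Multiset.mem_coe]
    have h1 := hpair (leftNormed_basic_mem F hQ ho h)
    have h2 : basicMonomial X s o i - basicMonomial X s o j ∈
        Submodule.span F (basicMonomial X s o '' s) :=
      Submodule.sub_mem _ (Submodule.subset_span ⟨i, by simp [hm], rfl⟩)
        (Submodule.subset_span ⟨j, by simp [hm], rfl⟩)
    have := Submodule.add_mem_sup h2 h1
    rwa [add_sub_cancel] at this
  · exact fun v hv => Submodule.mem_sup_right (hpair (Submodule.subset_span hv))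

end Span

end LiePI

namespace LiePI

/-! ### Potential of the pair monomials -/

section PairMonomial

variable {F Q : Type*} [Field F] [LieRing Q] [LieAlgebra F Q] (X : ℕ → Q)

/-- Carrying the `s.card - 4` remaining letters from one commutator to the other gives the power of
`-1`, and skew-symmetry of the outer bracket gives one more sign. The cocycle condition is the
Jacobi identity for `k, l, m`, the free letter of each tail being moved to its front. -/
theorem pairMonomial_isPairCocycle (hQ : IsCentreByMetabelian Q) (s : Finset ℕ) :
    IsPairCocycle (-(-1 : F) ^ (s.card - 4))
      (fun i j k l : s => pairMonomial X s (i : ℕ) j k l) where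
  skew_left i j k l := by
    simp only [pairMonomial]
    rw [← lie_skew (X j) (X i), neg_lie]
    congr 5
    ext a
    simp only [List.mem_toFinset, List.mem_cons, List.not_mem_nil, or_false]
    tauto
  skew_right i j k l := by
    simp only [pairMonomial]
    rw [leftNormed_skew, lie_neg]
    congr 5
    ext a
    simp only [List.mem_toFinset, List.mem_cons, List.not_mem_nil, or_false]
    tauto
  swap i j k l hd := by
    simp only [pairMonomial]
    have hc : [(k : ℕ), l, i, j].toFinset = [(i : ℕ), j, k, l].toFinset := by
      ext a
      simp only [List.mem_toFinset, List.mem_cons, List.not_mem_nil, or_false]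
      tauto
    have hsub : [(i : ℕ), j, k, l].toFinset ⊆ s := by
      intro a
      simp only [List.mem_toFinset, List.mem_cons, List.not_mem_nil, or_false]
      rintro (rfl | rfl | rfl | rfl) <;> simp
    have hlen : (s \ [(i : ℕ), j, k, l].toFinset).toList.length = s.card - 4 := by
      rw [Finset.length_toList, Finset.card_sdiff_of_subset hsub, List.toFinset_card_of_nodup]
      · rfl
      · simpa [← Subtype.ext_iff] using hd
    rw [hc, ← lie_skew, hQ.leftNormed_adjoint, hlen,
      hQ.leftNormed_perm (List.reverse_perm _), ← Int.cast_smul_eq_zsmul F]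
    simp
  cocycle i j k l m hd := by
    simp only [pairMonomial]
    have hp : ∀ a b c : s, [i, j, a, b, c].Perm [i, j, k, l, m] →
        (s \ [(i : ℕ), j, a, b].toFinset).toList.Perm
          ((c : ℕ) :: (s \ [(i : ℕ), j, k, l, m].toFinset).toList) := by
      intro a b c h
      have hn : [i, j, a, b, c].Nodup := h.nodup_iff.mpr hd
      have hmem : ∀ x : s, x ∈ [i, j, a, b, c] ↔ x ∈ [i, j, k, l, m] := fun x => h.mem_iff
      rw [List.perm_ext_iff_of_nodup (Finset.nodup_toList _)]
      · intro x
        by_cases hx : x ∈ s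
        · have := hmem ⟨x, hx⟩
          simp only [List.mem_cons, Subtype.ext_iff, List.not_mem_nil, or_false] at this
          simp only [List.nodup_cons, List.mem_cons, Subtype.ext_iff, List.not_mem_nil,
            or_false] at hn
          simp [hx]
          grind
        · have : x ≠ c := by rintro rfl; exact hx c.2
          simp [hx, this]
      · rw [List.nodup_cons]
        refine ⟨?_, Finset.nodup_toList _⟩
        have : c ∈ [i, j, k, l, m] := (hmem c).mp (by simp)
        simp only [List.mem_cons, Subtype.ext_iff, List.not_mem_nil, or_false] at this
        simp
        grind
    rw [hQ.leftNormed_perm (hp k l m (List.Perm.refl _)),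
      hQ.leftNormed_perm (hp l m k ?_), hQ.leftNormed_perm (hp m k l ?_)]
    · simp only [leftNormed_cons]
      rw [leftNormed_jacobi X (X k) (X l) (X m), ← lie_skew (X k) (X m), neg_lie, leftNormed_neg,
        ← lie_add, ← lie_add]
      convert lie_zero ⁅X (i : ℕ), X (j : ℕ)⁆ using 2
      abel
    · exact ((List.perm_append_comm (l₁ := [m]) (l₂ := [k, l])).cons j).cons i
    · exact ((List.perm_append_comm (l₁ := [l, m]) (l₂ := [k])).cons j).cons i

theorem exists_pairMonomial_potential (hQ : IsCentreByMetabelian Q) (h2 : (2 : F) ≠ 0)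
    (s : Finset ℕ) :
    ∃ φ : ℕ → ℕ → Q, (∀ p q, φ q p = (-(-1 : F) ^ (s.card - 4)) • φ p q) ∧
      ∀ q ∈ quadruples s, pairMonomial X s q.1 q.2.1 q.2.2.1 q.2.2.2 =
        φ q.2.1 q.2.2.2 - φ q.2.1 q.2.2.1 - φ q.1 q.2.2.2 + φ q.1 q.2.2.1 := by
  rcases (quadruples s).eq_empty_or_nonempty with h0 | ⟨⟨a, b, c, d⟩, hq⟩
  · exact ⟨0, by simp, by simp [h0]⟩
  have avoid : ∀ p : List s, p.length < s.card → ∃ m : s, m ∉ p := by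
    intro p hp
    by_contra! h
    have h1 := List.toFinset_card_le p
    have h2 : p.toFinset = Finset.univ := by ext x; simpa using h x
    rw [h2, Finset.card_univ, Fintype.card_coe] at h1
    omega
  simp only [quadruples, Finset.mem_filter, Finset.mem_product] at hq
  obtain ⟨⟨ha, hb, hc, hd⟩, hn⟩ := hq
  have h4 : 4 ≤ s.card := by
    have : [a, b, c, d].toFinset ⊆ s := by
      intro x
      simp only [List.mem_toFinset, List.mem_cons, List.not_mem_nil, or_false]
      rintro (rfl | rfl | rfl | rfl) <;> assumption
    have h := Finset.card_le_card this
    rwa [List.toFinset_card_of_nodup hn] at h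
  obtain ⟨φ, hφ, hw⟩ : ∃ φ : s → s → Q, (∀ p q, φ q p = (-(-1 : F) ^ (s.card - 4)) • φ p q) ∧
      ∀ i j k l : s, [i, j, k, l].Nodup → pairMonomial X s (i : ℕ) j k l =
        φ j l - φ j k - φ i l + φ i k := by
    have hw := pairMonomial_isPairCocycle (F := F) X hQ s
    rcases Nat.even_or_odd (s.card - 4) with he | he
    · rw [he.neg_one_pow] at hw ⊢
      refine hw.exists_potential_neg h2 ⟨a, ha⟩ fun x y z => ?_
      obtain ⟨m, hm⟩ := avoid [x, y, z] (by simp; omega)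
      exact ⟨m, by simpa using hm⟩
    · rw [he.neg_one_pow, neg_neg] at hw ⊢
      -- The symmetric case needs a fifth point; it is there because `s.card - 4` is odd, hence
      -- nonzero.
      have h5 : 4 < s.card := by
        rcases he with ⟨r, hr⟩
        omega
      refine hw.exists_potential_one h2 (o := ⟨a, ha⟩) (a := ⟨b, hb⟩) (b := ⟨c, hc⟩) ?_
        fun x y z t => ?_
      · simp at hn ⊢; grind
      · obtain ⟨m, hm⟩ := avoid [x, y, z, t] h5
        exact ⟨m, by simpa using hm⟩
  refine ⟨fun p q => if h : p ∈ s ∧ q ∈ s then φ ⟨p, h.1⟩ ⟨q, h.2⟩ else 0, fun p q => ?_, ?_⟩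
  · by_cases h : p ∈ s ∧ q ∈ s
    · simp only [dif_pos h, dif_pos h.symm, hφ ⟨p, h.1⟩]
    · have h' : ¬ (q ∈ s ∧ p ∈ s) := fun h' => h h'.symm
      simp only [dif_neg h, dif_neg h', smul_zero]
  · rintro ⟨i, j, k, l⟩ hq
    simp only [quadruples, Finset.mem_filter, Finset.mem_product] at hq
    obtain ⟨⟨hi, hj, hk, hl⟩, hn⟩ := hq
    simp only [hi, hj, hk, hl, and_self, dif_pos]
    exact hw ⟨i, hi⟩ ⟨j, hj⟩ ⟨k, hk⟩ ⟨l, hl⟩ (by simpa using hn)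

/-- A combination of the monomials `[[x_i, x_j], [x_k, x_l, …]]` vanishes as soon as a certain
bilinear form of its coefficients does. -/
theorem sum_pairMonomial_eq_zero (hQ : IsCentreByMetabelian Q) (h2 : (2 : F) ≠ 0)
    (s : Finset ℕ) (c : ℕ × ℕ × ℕ × ℕ → F)
    (hc : ∀ x y : ℕ → F, ∑ q ∈ quadruples s,
      c q * ((x q.2.1 - x q.1) * (y q.2.2.2 - y q.2.2.1) +
        (-(-1 : F) ^ (s.card - 4)) * ((y q.2.1 - y q.1) * (x q.2.2.2 - x q.2.2.1))) = 0) :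
    ∑ q ∈ quadruples s, c q • pairMonomial X s q.1 q.2.1 q.2.2.1 q.2.2.2 = 0 := by
  obtain ⟨φ, hφ, hw⟩ := exists_pairMonomial_potential X hQ h2 s
  set e : F := -(-1 : F) ^ (s.card - 4)
  -- Testing the hypothesis on indicator functions extracts the matrix `M` of the form, with `M p r
  -- = -e * M r p`.
  let δ : ℕ → ℕ → F := fun p i => if i = p then 1 else 0
  let M : ℕ → ℕ → F := fun p r => ∑ q ∈ quadruples s,
    c q * ((δ p q.2.1 - δ p q.1) * (δ r q.2.2.2 - δ r q.2.2.1))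
  have hM : ∀ p r, M p r + e * M r p = 0 := by
    intro p r
    rw [← hc (δ p) (δ r), Finset.mul_sum, ← Finset.sum_add_distrib]
    exact Finset.sum_congr rfl fun q _ => by ring
  have hsum : ∀ i ∈ s, ∀ j ∈ s, ∑ p ∈ s, ∑ r ∈ s, (δ p i * δ r j) • φ p r = φ i j := by
    intro i hi j hj
    simp [δ, hi, hj, ite_smul, Finset.sum_ite_eq]
  have hS : ∑ q ∈ quadruples s, c q • pairMonomial X s q.1 q.2.1 q.2.2.1 q.2.2.2 =
      ∑ p ∈ s, ∑ r ∈ s, M p r • φ p r := by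
    have : ∀ p r, M p r • φ p r = ∑ q ∈ quadruples s,
        (c q * ((δ p q.2.1 - δ p q.1) * (δ r q.2.2.2 - δ r q.2.2.1))) • φ p r := fun p r =>
      Finset.sum_smul
    simp only [this]
    rw [Finset.sum_congr rfl fun p _ => Finset.sum_comm, Finset.sum_comm]
    refine Finset.sum_congr rfl fun q hq => ?_
    rw [hw q hq]
    simp only [quadruples, Finset.mem_filter, Finset.mem_product] at hq
    obtain ⟨⟨hi, hj, hk, hl⟩, -⟩ := hq
    rw [← hsum _ hj _ hl, ← hsum _ hj _ hk, ← hsum _ hi _ hl, ← hsum _ hi _ hk]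
    simp only [← Finset.sum_sub_distrib, ← Finset.sum_add_distrib, Finset.smul_sum]
    refine Finset.sum_congr rfl fun p _ => Finset.sum_congr rfl fun r _ => ?_
    module
  -- `M` and `φ` have opposite symmetry under transposition, so their pairing equals its own
  -- negative.
  have h0 : (2 : F) • ∑ p ∈ s, ∑ r ∈ s, M p r • φ p r = 0 := by
    have hcomm : ∑ p ∈ s, ∑ r ∈ s, M p r • φ p r = ∑ p ∈ s, ∑ r ∈ s, (e * M r p) • φ p r := by
      rw [Finset.sum_comm]
      refine Finset.sum_congr rfl fun p _ => Finset.sum_congr rfl fun r _ => ?_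
      rw [hφ p r, smul_smul, mul_comm]
    rw [two_smul]
    nth_rw 2 [hcomm]
    simp only [← Finset.sum_add_distrib, ← add_smul, hM, zero_smul, Finset.sum_const_zero]
  rw [hS]
  exact (smul_eq_zero.mp h0).resolve_left h2

end PairMonomial

end LiePI

namespace LiePI

/-! ### The diamond Lie algebra -/

/-- The diamond Lie algebra: the Heisenberg algebra with basis `b, d, s`, `[b, d] = s`, extended
by the derivation `t`, `[t, b] = b`, `[t, d] = -d`. -/
@[ext] structure Diamond (F : Type*) where
  t : F
  b : F
  d : F
  s : F

namespace Diamond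

variable {F : Type*} [Field F]

instance : Zero (Diamond F) := ⟨⟨0, 0, 0, 0⟩⟩
instance : Add (Diamond F) := ⟨fun u v => ⟨u.t + v.t, u.b + v.b, u.d + v.d, u.s + v.s⟩⟩
instance : Neg (Diamond F) := ⟨fun u => ⟨-u.t, -u.b, -u.d, -u.s⟩⟩
instance : SMul F (Diamond F) := ⟨fun c u => ⟨c * u.t, c * u.b, c * u.d, c * u.s⟩⟩
instance : Bracket (Diamond F) (Diamond F) :=
  ⟨fun u v => ⟨0, u.t * v.b - v.t * u.b, -(u.t * v.d - v.t * u.d), u.b * v.d - u.d * v.b⟩⟩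

@[simp] theorem zero_t : (0 : Diamond F).t = 0 := rfl
@[simp] theorem zero_b : (0 : Diamond F).b = 0 := rfl
@[simp] theorem zero_d : (0 : Diamond F).d = 0 := rfl
@[simp] theorem zero_s : (0 : Diamond F).s = 0 := rfl
@[simp] theorem add_t (u v : Diamond F) : (u + v).t = u.t + v.t := rfl
@[simp] theorem add_b (u v : Diamond F) : (u + v).b = u.b + v.b := rfl
@[simp] theorem add_d (u v : Diamond F) : (u + v).d = u.d + v.d := rfl
@[simp] theorem add_s (u v : Diamond F) : (u + v).s = u.s + v.s := rfl
@[simp] theorem neg_t (u : Diamond F) : (-u).t = -u.t := rfl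
@[simp] theorem neg_b (u : Diamond F) : (-u).b = -u.b := rfl
@[simp] theorem neg_d (u : Diamond F) : (-u).d = -u.d := rfl
@[simp] theorem neg_s (u : Diamond F) : (-u).s = -u.s := rfl
@[simp] theorem smul_t (c : F) (u : Diamond F) : (c • u).t = c * u.t := rfl
@[simp] theorem smul_b (c : F) (u : Diamond F) : (c • u).b = c * u.b := rfl
@[simp] theorem smul_d (c : F) (u : Diamond F) : (c • u).d = c * u.d := rfl
@[simp] theorem smul_s (c : F) (u : Diamond F) : (c • u).s = c * u.s := rfl
@[simp] theorem lie_t (u v : Diamond F) : ⁅u, v⁆.t = 0 := rfl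
@[simp] theorem lie_b (u v : Diamond F) : ⁅u, v⁆.b = u.t * v.b - v.t * u.b := rfl
@[simp] theorem lie_d (u v : Diamond F) : ⁅u, v⁆.d = -(u.t * v.d - v.t * u.d) := rfl
@[simp] theorem lie_s (u v : Diamond F) : ⁅u, v⁆.s = u.b * v.d - u.d * v.b := rfl

instance : AddCommGroup (Diamond F) where
  add_assoc u v w := by ext <;> simp [add_assoc]
  zero_add u := by ext <;> simp
  add_zero u := by ext <;> simp
  neg_add_cancel u := by ext <;> simp
  add_comm u v := by ext <;> simp [add_comm]
  nsmul := nsmulRec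
  zsmul := zsmulRec

instance : Module F (Diamond F) where
  one_smul u := by ext <;> simp
  mul_smul a b u := by ext <;> simp [mul_assoc]
  smul_zero a := by ext <;> simp
  smul_add a u v := by ext <;> simp [mul_add]
  add_smul a b u := by ext <;> simp [add_mul]
  zero_smul u := by ext <;> simp

instance : LieRing (Diamond F) where
  add_lie u v w := by ext <;> simp <;> ring
  lie_add u v w := by ext <;> simp <;> ring
  lie_self u := by ext <;> simp [mul_comm]
  leibniz_lie u v w := by ext <;> simp <;> ring

instance : LieAlgebra F (Diamond F) where
  lie_smul c u v := by ext <;> simp <;> ring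

/-- The derived algebra lies in the Heisenberg algebra, whose commutators are multiples of the
central `s`. -/
theorem isCentreByMetabelian : IsCentreByMetabelian (Diamond F) := by
  intro x y z t u
  ext <;> simp [-lie_lie]

/-- The coordinate `b`. -/
def coordB : Diamond F →ₗ[F] F where
  toFun := b
  map_add' _ _ := rfl
  map_smul' _ _ := rfl

/-- The coordinate `s`. -/
def coordS : Diamond F →ₗ[F] F where
  toFun := s
  map_add' _ _ := rfl
  map_smul' _ _ := rfl

/-- A family of elements of the diamond algebra with `t`-coordinate one. -/
def point (x y : ℕ → F) (i : ℕ) : Diamond F := ⟨1, x i, y i, 0⟩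

variable (x y : ℕ → F)

/-- As the `t`-coordinate of each point is one, right bracketing with any of them has eigenvalue
`-1` on `b` and `1` on `d`, modulo `s`. -/
theorem leftNormed_point (u : Diamond F) (hu : u.t = 0) (l : List ℕ) :
    (leftNormed (point x y) u l).b = (-1) ^ l.length * u.b ∧
      (leftNormed (point x y) u l).d = u.d ∧ (leftNormed (point x y) u l).t = 0 := by
  induction l generalizing u with
  | nil => simp [hu]
  | cons r l ih =>
    obtain ⟨h1, h2, h3⟩ := ih ⁅u, point x y r⁆ (by simp)
    rw [leftNormed_cons, h1, h2, h3]
    simp [hu, point, pow_succ]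

theorem coordB_basicMonomial (s : Finset ℕ) (o i : ℕ) :
    coordB (basicMonomial (point x y) s o i) =
      (-1) ^ (s \ [i, o].toFinset).toList.length * (x o - x i) := by
  refine (leftNormed_point x y _ (by simp) _).1.trans ?_
  simp [point]

theorem coordB_pairMonomial (s : Finset ℕ) (i j k l : ℕ) :
    coordB (pairMonomial (point x y) s i j k l) = 0 := by
  have h := (leftNormed_point x y ⁅point x y k, point x y l⁆ (by simp)
    (s \ [i, j, k, l].toFinset).toList).2.2
  simp only [coordB, pairMonomial, LinearMap.coe_mk, AddHom.coe_mk, lie_b, lie_t, h]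
  ring

/-- The opposite eigenvalues on `b` and `d` reproduce the sign of the pair cocycle, so this is, up
to a minus, the form tested in `sum_pairMonomial_eq_zero`. -/
theorem coordS_pairMonomial {s : Finset ℕ} {q : ℕ × ℕ × ℕ × ℕ} (hq : q ∈ quadruples s) :
    coordS (pairMonomial (point x y) s q.1 q.2.1 q.2.2.1 q.2.2.2) =
      -((x q.2.1 - x q.1) * (y q.2.2.2 - y q.2.2.1) +
        (-(-1 : F) ^ (s.card - 4)) * ((y q.2.1 - y q.1) * (x q.2.2.2 - x q.2.2.1))) := by
  obtain ⟨i, j, k, l⟩ := q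
  simp only [quadruples, Finset.mem_filter, Finset.mem_product] at hq
  obtain ⟨⟨hi, hj, hk, hl⟩, hn⟩ := hq
  have hsub : [i, j, k, l].toFinset ⊆ s := by
    intro a
    simp only [List.mem_toFinset, List.mem_cons, List.not_mem_nil, or_false]
    rintro (rfl | rfl | rfl | rfl) <;> assumption
  have hlen : (s \ [i, j, k, l].toFinset).toList.length = s.card - 4 := by
    rw [Finset.length_toList, Finset.card_sdiff_of_subset hsub, List.toFinset_card_of_nodup hn]
    rfl
  obtain ⟨h1, h2, -⟩ := leftNormed_point x y ⁅point x y k, point x y l⁆ (by simp)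
    (s \ [i, j, k, l].toFinset).toList
  rw [hlen] at h1
  simp only [coordS, pairMonomial, LinearMap.coe_mk, AddHom.coe_mk, lie_s, h1, h2]
  simp [point]
  ring

end Diamond

/-! ### Multilinear identities of the diamond algebra -/

section Verbal

variable {F : Type*} [Field F]

theorem lift_centreByMetabelian {Q : Type*} [LieRing Q] [LieAlgebra F Q] (b : ℕ → Q) :
    FreeLieAlgebra.lift F b (centreByMetabelian F) = ⁅⁅⁅b 0, b 1⁆, ⁅b 2, b 3⁆⁆, b 4⁆ := by
  simp [centreByMetabelian, LieHom.map_lie, FreeLieAlgebra.lift_of_apply]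

theorem map_eq_zero_of_mem_verbalIdeal {Q : Type*} [LieRing Q] [LieAlgebra F Q]
    (hQ : IsCentreByMetabelian Q) (g : FreeLieAlgebra F ℕ →ₗ⁅F⁆ Q) {f : FreeLieAlgebra F ℕ}
    (hf : f ∈ verbalIdeal (centreByMetabelian F)) : g f = 0 := by
  have : verbalIdeal (centreByMetabelian F) ≤ g.ker := by
    refine LieSubmodule.lieSpan_le.mpr ?_
    rintro _ ⟨b, rfl⟩
    rw [lift_centreByMetabelian]
    simp only [SetLike.mem_coe, LieHom.mem_ker, LieHom.map_lie]
    exact hQ _ _ _ _ _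
  exact LieHom.mem_ker.mp (this hf)

variable (F) in
/-- The relatively free centre-by-metabelian Lie algebra. -/
abbrev RelFree : Type _ := FreeLieAlgebra F ℕ ⧸ verbalIdeal (centreByMetabelian F)

variable (F) in
/-- The projection of the free Lie algebra onto the relatively free one. -/
noncomputable def toRelFree : FreeLieAlgebra F ℕ →ₗ⁅F⁆ RelFree F where
  toLinearMap := (LieSubmodule.Quotient.mk' (verbalIdeal (centreByMetabelian F))).toLinearMap
  map_lie' := fun {_ _} => LieSubmodule.Quotient.mk_bracket _ _ _

theorem toRelFree_eq_zero {f : FreeLieAlgebra F ℕ} :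
    toRelFree F f = 0 ↔ f ∈ verbalIdeal (centreByMetabelian F) :=
  LieSubmodule.Quotient.mk_eq_zero _

theorem toRelFree_surjective : Function.Surjective (toRelFree F) :=
  LieSubmodule.Quotient.surjective_mk' _

theorem relFree_isCentreByMetabelian : IsCentreByMetabelian (RelFree F) := by
  intro x y z t u
  obtain ⟨x, rfl⟩ := toRelFree_surjective x
  obtain ⟨y, rfl⟩ := toRelFree_surjective y
  obtain ⟨z, rfl⟩ := toRelFree_surjective z
  obtain ⟨t, rfl⟩ := toRelFree_surjective t
  obtain ⟨u, rfl⟩ := toRelFree_surjective u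
  simp only [← LieHom.map_lie]
  rw [toRelFree_eq_zero]
  refine LieSubmodule.subset_lieSpan ⟨fun n => match n with
    | 0 => x | 1 => y | 2 => z | 3 => t | _ => u, ?_⟩
  exact lift_centreByMetabelian _

theorem map_basicMonomial {P Q : Type*} [LieRing P] [LieAlgebra F P] [LieRing Q] [LieAlgebra F Q]
    (g : P →ₗ⁅F⁆ Q) (X : ℕ → P) (s : Finset ℕ) (o i : ℕ) :
    g (basicMonomial X s o i) = basicMonomial (fun n => g (X n)) s o i := by
  simp [basicMonomial, map_leftNormed, LieHom.map_lie]

theorem map_pairMonomial {P Q : Type*} [LieRing P] [LieAlgebra F P] [LieRing Q] [LieAlgebra F Q]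
    (g : P →ₗ⁅F⁆ Q) (X : ℕ → P) (s : Finset ℕ) (i j k l : ℕ) :
    g (pairMonomial X s i j k l) = pairMonomial (fun n => g (X n)) s i j k l := by
  simp [pairMonomial, map_leftNormed, LieHom.map_lie]

/-- Modulo the centre-by-metabelian law, a multilinear element is a combination of the normal
monomials or of degree one. -/
theorem toRelFree_mem_span {s : Finset ℕ} {f : FreeLieAlgebra F ℕ}
    (hf : f ∈ Submodule.span F {h : FreeLieAlgebra F ℕ | ∃ w : FreeMagma ℕ,
        (∀ i, wordDegree i w = if i ∈ s then 1 else 0) ∧ lieMonomial F w = h}) :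
    (∃ i, f ∈ Submodule.span F {FreeLieAlgebra.of F i}) ∨
      toRelFree F f ∈ monomialSpan F (fun i => toRelFree F (FreeLieAlgebra.of F i)) s.val := by
  have hlift : toRelFree F =
      FreeLieAlgebra.lift F (fun i => toRelFree F (FreeLieAlgebra.of F i)) :=
    (FreeLieAlgebra.lift_unique _ _).mp rfl
  by_cases hs : ∃ i, s = {i}
  · obtain ⟨i, rfl⟩ := hs
    left
    refine ⟨i, Submodule.span_mono ?_ hf⟩
    rintro _ ⟨w, hw, rfl⟩
    have hl := letters_eq_val hw
    rcases w with j | ⟨v, w⟩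
    · have : j = i := by simpa [letters] using hl
      subst this
      rfl
    · exfalso
      have hpos : ∀ w : FreeMagma ℕ, 0 < (letters w).card := fun w => by
        induction w with
        | ih1 i => simp [letters]
        | ih2 v w hv _ => exact (Multiset.card_add (letters v) (letters w)).symm ▸
            Nat.add_pos_left hv _
      have h1 : (letters v).card + (letters w).card = 1 := by
        rw [← Multiset.card_add]
        exact congrArg Multiset.card hl
      have := hpos v
      have := hpos w
      omega
  · right
    suffices H : Submodule.span F _ ≤ (monomialSpan F
      (fun i => toRelFree F (FreeLieAlgebra.of F i)) s.val).comap (toRelFree F).toLinearMap from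
        H hf
    refine Submodule.span_le.mpr ?_
    rintro _ ⟨w, hw, rfl⟩
    have hl := letters_eq_val hw
    rcases lift_lieMonomial_mem F (X := fun i => toRelFree F (FreeLieAlgebra.of F i))
      relFree_isCentreByMetabelian w with ⟨i, rfl⟩ | h
    · exact absurd ⟨i, Finset.val_injective hl.symm⟩ hs
    · rw [hl, ← hlift] at h
      exact h

theorem isConsequence_of_diamond (h2 : (2 : F) ≠ 0) {f : FreeLieAlgebra F ℕ}
    (hf : IsMultilinear f) (hD : IsIdentity (Diamond F) f) :
    IsConsequence f (centreByMetabelian F) := by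
  obtain ⟨s, hf⟩ := hf
  set X : ℕ → RelFree F := fun i => toRelFree F (FreeLieAlgebra.of F i) with hX
  rcases toRelFree_mem_span hf with ⟨i, hi⟩ | hf'
  · obtain ⟨c, rfl⟩ := Submodule.mem_span_singleton.mp hi
    -- In degree one the law imposes nothing; a value outside the derived algebra shows that the
    -- coefficient is zero.
    have := congrArg Diamond.t (hD fun _ => ⟨1, 0, 0, 0⟩)
    rw [map_smul, FreeLieAlgebra.lift_of_apply] at this
    have hc : c = 0 := by simpa using this
    rw [hc, zero_smul]
    exact (verbalIdeal (centreByMetabelian F)).zero_mem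
  have hQ := relFree_isCentreByMetabelian (F := F)
  rcases s.eq_empty_or_nonempty with rfl | ⟨o, ho⟩
  · have : f = 0 := by
      rw [← Submodule.mem_bot F]
      refine (Submodule.span_le.mpr ?_) hf
      rintro _ ⟨w, hw, rfl⟩
      exfalso
      have hl := letters_eq_val hw
      have hpos : ∀ w : FreeMagma ℕ, letters w ≠ 0 := fun w => by
        induction w with
        | ih1 i => simp [letters]
        | ih2 v w hv _ => exact fun h => hv (add_eq_zero.mp h).1
      exact hpos w hl
    rw [this]
    exact (verbalIdeal (centreByMetabelian F)).zero_mem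
  obtain ⟨u, hu, v, hv, huv⟩ := Submodule.mem_sup.mp (monomialSpan_val_le F hQ ho hf')
  obtain ⟨a, rfl⟩ := (Submodule.mem_span_image_finset_iff_exists_fun' F).mp hu
  obtain ⟨c, rfl⟩ := (Submodule.mem_span_image_finset_iff_exists_fun' F).mp hv
  clear hu hv
  -- the same combination in the free Lie algebra
  set f' : FreeLieAlgebra F ℕ := ∑ i ∈ s, a i • basicMonomial (FreeLieAlgebra.of F) s o i +
    ∑ q ∈ quadruples s, c q • pairMonomial (FreeLieAlgebra.of F) s q.1 q.2.1 q.2.2.1 q.2.2.2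
  have hmap : ∀ {P : Type _} [LieRing P] [LieAlgebra F P] (g : FreeLieAlgebra F ℕ →ₗ⁅F⁆ P),
      g f' = ∑ i ∈ s, a i • basicMonomial (fun n => g (FreeLieAlgebra.of F n)) s o i +
        ∑ q ∈ quadruples s, c q •
          pairMonomial (fun n => g (FreeLieAlgebra.of F n)) s q.1 q.2.1 q.2.2.1 q.2.2.2 := by
    intro P _ _ g
    simp [f', map_basicMonomial, map_pairMonomial]
  have hff' : f - f' ∈ verbalIdeal (centreByMetabelian F) := by
    rw [← toRelFree_eq_zero, map_sub, hmap, ← huv, sub_self]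
  have heval : ∀ x y : ℕ → F, ∑ i ∈ s, a i • basicMonomial (Diamond.point x y) s o i +
      ∑ q ∈ quadruples s, c q •
        pairMonomial (Diamond.point x y) s q.1 q.2.1 q.2.2.1 q.2.2.2 = 0 := by
    intro x y
    have h1 := map_eq_zero_of_mem_verbalIdeal Diamond.isCentreByMetabelian
      (FreeLieAlgebra.lift F (Diamond.point x y)) hff'
    rw [map_sub, hD, zero_sub, neg_eq_zero, hmap] at h1
    simpa only [FreeLieAlgebra.lift_of_apply] using h1
  -- The `b`-coordinate of `[x_i, x_o, …]` is `±(x o - x i)` and pair monomials have none, so the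
  -- indicator of `i` isolates `a i`. The coefficient `a o` stays undetermined, but its monomial
  -- begins with `[x_o, x_o] = 0`.
  have ha : ∀ i ∈ s, i ≠ o → a i = 0 := by
    intro i hi hio
    have h1 := congrArg Diamond.coordB (heval (fun n => if n = i then 1 else 0) 0)
    simp only [map_add, map_sum, map_smul, Diamond.coordB_basicMonomial,
      Diamond.coordB_pairMonomial, mul_zero, Finset.sum_const_zero, add_zero, map_zero,
      smul_eq_mul] at h1
    rw [Finset.sum_eq_single i] at h1
    · simpa [Ne.symm hio] using h1
    · intro j _ hj
      simp [hj, Ne.symm hio]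
    · exact fun h => absurd hi h
  have hbasic : ∀ {P : Type _} [LieRing P] [LieAlgebra F P] (Y : ℕ → P),
      ∑ i ∈ s, a i • basicMonomial Y s o i = 0 := by
    intro P _ _ Y
    refine Finset.sum_eq_zero fun i hi => ?_
    by_cases hio : i = o
    · subst hio
      simp [basicMonomial, leftNormed_zero]
    · rw [ha i hi hio, zero_smul]
  have hpair := sum_pairMonomial_eq_zero X hQ h2 s c fun x y => by
    have h1 := congrArg Diamond.coordS (heval x y)
    rw [hbasic, zero_add, map_sum, map_zero] at h1
    rw [← neg_eq_zero, ← h1, ← Finset.sum_neg_distrib]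
    refine Finset.sum_congr rfl fun q hq => ?_
    rw [map_smul, Diamond.coordS_pairMonomial x y hq, smul_eq_mul]
    ring
  rw [hbasic, hpair, add_zero] at huv
  exact toRelFree_eq_zero.mp huv.symm

end Verbal

end LiePI

namespace LiePI

/-! ### The diamond algebra inside `M₁,₁` -/

section GrassmannProducts

variable {F : Type*} [Field F]

theorem gen_mul_self (i : ℕ) : gen F i * gen F i = 0 := ExteriorAlgebra.ι_sq_zero _

theorem ι_mul_ι_swap (v w : ℕ →₀ F) :
    ExteriorAlgebra.ι F v * ExteriorAlgebra.ι F w =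
      -(ExteriorAlgebra.ι F w * ExteriorAlgebra.ι F v) :=
  eq_neg_of_add_eq_zero_left (ExteriorAlgebra.ι_add_mul_swap v w)

theorem gen_mul_gen_mem_center (i j : ℕ) :
    gen F i * gen F j ∈ Subalgebra.center F (GrassmannOne F) := by
  rw [Subalgebra.mem_center_iff]
  intro x
  induction x using ExteriorAlgebra.induction with
  | algebraMap r => exact Algebra.commutes r _
  | ι v =>
    rw [gen, gen, ← mul_assoc, ι_mul_ι_swap v, neg_mul, mul_assoc, ι_mul_ι_swap v, mul_neg, neg_neg,
      mul_assoc]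
  | mul x y hx hy => rw [mul_assoc, hy, ← mul_assoc, hx, mul_assoc]
  | add x y hx hy => rw [mul_add, add_mul, hx, hy]

/-- The contraction with the `i`-th coordinate kills the products without `eᵢ`. -/
theorem contractLeft_gen_prod (i : ℕ) (l : List ℕ) (hi : i ∉ l) :
    CliffordAlgebra.contractLeft (Q := (0 : QuadraticForm F (ℕ →₀ F)))
      (Finsupp.lapply i : (ℕ →₀ F) →ₗ[F] F) ((l.map (gen F)).prod : GrassmannOne F) = 0 := by
  induction l with
  | nil =>
    exact CliffordAlgebra.contractLeft_one (Q := (0 : QuadraticForm F (ℕ →₀ F)))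
      (Finsupp.lapply i : (ℕ →₀ F) →ₗ[F] F)
  | cons j l ih =>
    rw [List.map_cons, List.prod_cons]
    refine (CliffordAlgebra.contractLeft_ι_mul (Q := (0 : QuadraticForm F (ℕ →₀ F)))
      (Finsupp.lapply i : (ℕ →₀ F) →ₗ[F] F) _ _).trans ?_
    rw [ih fun h => hi (List.mem_cons_of_mem _ h)]
    have : j ≠ i := by rintro rfl; exact hi (List.mem_cons_self)
    simp [this]

/-- Contraction with the coordinate of the first generator strips it off, since that generator does
not recur. -/
theorem gen_prod_ne_zero {l : List ℕ} (hl : l.Nodup) :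
    ((l.map (gen F)).prod : GrassmannOne F) ≠ 0 := by
  induction l with
  | nil => simp
  | cons i l ih =>
    rw [List.nodup_cons] at hl
    intro h
    rw [List.map_cons, List.prod_cons] at h
    have h1 := CliffordAlgebra.contractLeft_ι_mul (Q := (0 : QuadraticForm F (ℕ →₀ F)))
      (Finsupp.lapply i : (ℕ →₀ F) →ₗ[F] F) (Finsupp.single i 1)
      ((l.map (gen F)).prod : GrassmannOne F)
    rw [contractLeft_gen_prod i l hl.1] at h1
    have h2 : CliffordAlgebra.ι (0 : QuadraticForm F (ℕ →₀ F)) (Finsupp.single i 1) *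
        ((l.map (gen F)).prod : GrassmannOne F) = 0 := h
    rw [h2] at h1
    refine ih hl.2 ?_
    simpa using h1.symm

variable (F) in
/-- Central elements of even length, in disjoint sets of generators. -/
noncomputable def pairGen (m : ℕ) : Subalgebra.center F (GrassmannOne F) :=
  -- The shift by 2 keeps `e₀` and `e₁` free for the matrices of the diamond algebra.
  ⟨gen F (2 * m + 2) * gen F (2 * m + 3), gen_mul_gen_mem_center _ _⟩

theorem pairGen_prod_mul_ne_zero (s : Finset ℕ) :
    (((s.val.map (pairGen F)).prod : Subalgebra.center F (GrassmannOne F)) : GrassmannOne F) *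
      (gen F 0 * gen F 1) ≠ 0 := by
  have key : ∀ l : List ℕ,
      (((l.map (pairGen F)).prod : Subalgebra.center F (GrassmannOne F)) : GrassmannOne F) =
        ((l.flatMap fun m => [2 * m + 2, 2 * m + 3]).map (gen F)).prod := by
    intro l
    induction l with
    | nil => rfl
    | cons m l ih =>
      rw [List.map_cons, List.prod_cons, MulMemClass.coe_mul, ih]
      simp [pairGen, mul_assoc]
  have h : gen F 0 * gen F 1 = (([0, 1] : List ℕ).map (gen F)).prod := by simp
  rw [← Finset.coe_toList, Multiset.map_coe, Multiset.prod_coe, key, h, ← List.prod_append,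
    ← List.map_append]
  refine gen_prod_ne_zero ?_
  rw [List.nodup_append, List.nodup_flatMap]
  refine ⟨⟨fun m _ => by simp, (Finset.nodup_toList s).imp fun {a b} hab => ?_⟩, by simp, ?_⟩
  · intro x hx hy
    simp at hx hy
    omega
  · intro a ha b hb
    simp at ha hb
    omega

end GrassmannProducts

/-! ### From the diamond algebra to matrices over the Grassmann algebra -/

section Embedding

attribute [local instance] LieRing.ofAssociativeRing

variable (F : Type*) [Field F]

/-- The embedding of the diamond algebra into `M₁,₁(E¹)`. -/
noncomputable def diamondMatrix : Diamond F →ₗ[F] Matrix (Fin 2) (Fin 2) (GrassmannOne F) where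
  -- The image of `s` is scalar because `e₀` and `e₁` anticommute: `[e₀E₁₂, e₁E₂₁] = e₀e₁(E₁₁ +
  -- E₂₂)`. The image of `t` is `E₁₁`.
  toFun u := !![u.t • 1 + u.s • (gen F 0 * gen F 1), u.b • gen F 0;
    u.d • gen F 1, u.s • (gen F 0 * gen F 1)]
  map_add' u v := by
    ext i j
    fin_cases i <;> fin_cases j <;> (simp [add_smul]; try abel)
  map_smul' c u := by
    ext i j
    fin_cases i <;> fin_cases j <;> simp [mul_smul]

variable {F}

theorem diamondMatrix_lie (u v : Diamond F) : diamondMatrix F ⁅u, v⁆ =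
    diamondMatrix F u * diamondMatrix F v - diamondMatrix F v * diamondMatrix F u := by
  have h00 := gen_mul_self (F := F) 0
  have h11 := gen_mul_self (F := F) 1
  have h10 : gen F 1 * gen F 0 = -(gen F 0 * gen F 1) := ι_mul_ι_swap _ _
  have a1 : gen F 0 * (gen F 0 * gen F 1) = 0 := by rw [← mul_assoc, h00, zero_mul]
  have a2 : gen F 0 * gen F 1 * gen F 1 = 0 := by rw [mul_assoc, h11, mul_zero]
  have a3 : gen F 0 * gen F 1 * gen F 0 = 0 := by rw [mul_assoc, h10, mul_neg, a1, neg_zero]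
  have a4 : gen F 1 * (gen F 0 * gen F 1) = 0 := by rw [← mul_assoc, h10, neg_mul, a2, neg_zero]
  have a5 : gen F 0 * gen F 1 * (gen F 0 * gen F 1) = 0 := by rw [← mul_assoc, a3, zero_mul]
  ext i j
  fin_cases i <;> fin_cases j <;>
    simp only [diamondMatrix, LinearMap.coe_mk, AddHom.coe_mk, Matrix.sub_apply, Matrix.mul_apply,
      Fin.sum_univ_two, Fin.zero_eta, Fin.mk_one, Matrix.of_apply, Matrix.cons_val_zero,
      Matrix.cons_val_one, Matrix.cons_val', Matrix.cons_val_fin_one, Diamond.lie_t, Diamond.lie_b,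
      Diamond.lie_d, Diamond.lie_s, add_mul, mul_add, smul_mul_smul_comm, mul_one, one_mul,
      h10, a1, a2, a3, a4, a5] <;>
    module

/-- The matrices of the diamond algebra, multiplied by an even product of generators. -/
theorem pairGen_smul_diamondMatrix_mem (m : ℕ) (u : Diamond F) :
    (pairGen F m : GrassmannOne F) • diamondMatrix F u ∈ adjointLie (M11E F) := by
  have hmem : ∀ (P : ℕ → Prop) (l : List ℕ), P (l.length + 2) →
      (pairGen F m : GrassmannOne F) * (l.map (gen F)).prod ∈ lengthSpan F P := by
    intro P l hl
    refine Submodule.subset_span ⟨[2 * m + 2, 2 * m + 3] ++ l, by simpa using hl, ?_⟩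
    simp [pairGen, mul_assoc]
  -- The unit in the image of `t` becomes a product of two generators; this is what brings the
  -- matrices into `M₁,₁(E)`.
  have h1 := hmem (fun n => Even n ∧ 0 < n) [] ⟨by decide, by decide⟩
  have h2 := hmem (fun n => Even n ∧ 0 < n) [0, 1] ⟨by decide, by decide⟩
  have h3 := hmem Odd [0] (by decide)
  have h4 := hmem Odd [1] (by decide)
  simp only [List.map_nil, List.prod_nil, List.map_cons, List.prod_cons, mul_one] at h1 h2 h3 h4
  refine ⟨⟨?_, ?_⟩, ?_, ?_⟩
  · change (pairGen F m : GrassmannOne F) * (u.t • 1 + u.s • (gen F 0 * gen F 1)) ∈ evenPart F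
    rw [mul_add, mul_smul_comm, mul_smul_comm, mul_one]
    exact Submodule.add_mem _ (Submodule.smul_mem _ _ h1) (Submodule.smul_mem _ _ h2)
  · change (pairGen F m : GrassmannOne F) * (u.s • (gen F 0 * gen F 1)) ∈ evenPart F
    rw [mul_smul_comm]
    exact Submodule.smul_mem _ _ h2
  · change (pairGen F m : GrassmannOne F) * (u.b • gen F 0) ∈ oddPart F
    rw [mul_smul_comm]
    exact Submodule.smul_mem _ _ h3
  · change (pairGen F m : GrassmannOne F) * (u.d • gen F 1) ∈ oddPart F
    rw [mul_smul_comm]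
    exact Submodule.smul_mem _ _ h4

/-- The substitution of `hₘ uₘ` for the variable `xₘ`, where `hₘ` is central of even length. -/
noncomputable def diamondSubst (u : ℕ → Diamond F) (m : ℕ) : adjointLie (M11E F) :=
  ⟨(pairGen F m : GrassmannOne F) • diamondMatrix F (u m), pairGen_smul_diamondMatrix_mem m (u m)⟩

theorem center_smul_mul_smul {n : Type*} [Fintype n] {A : Type*} [Ring A] [Algebra F A]
    (x y : Subalgebra.center F A) (M N : Matrix n n A) :
    ((x : A) • M) * ((y : A) • N) = ((x * y : Subalgebra.center F A) : A) • (M * N) := by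
  ext i j
  simp only [Matrix.mul_apply, Matrix.smul_apply, smul_eq_mul, Finset.mul_sum,
    MulMemClass.coe_mul]
  refine Finset.sum_congr rfl fun k _ => ?_
  have h := Subalgebra.mem_center_iff.mp y.2 (M i k)
  rw [mul_assoc, ← mul_assoc (M i k), h]
  simp only [mul_assoc]

/-- The factors are central and so come out of every bracket. Their product depends only on the
letters of the word, hence is common to all words of a multilinear element. -/
theorem lift_diamondSubst_lieMonomial (u : ℕ → Diamond F) (w : FreeMagma ℕ) :
    ((FreeLieAlgebra.lift F (diamondSubst u) (lieMonomial F w) : adjointLie (M11E F)) :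
        Matrix (Fin 2) (Fin 2) (GrassmannOne F)) =
      ((((letters w).map (pairGen F)).prod : Subalgebra.center F (GrassmannOne F)) :
        GrassmannOne F) • diamondMatrix F (FreeLieAlgebra.lift F u (lieMonomial F w)) := by
  induction w with
  | ih1 i =>
    simp [lieMonomial, letters, FreeLieAlgebra.lift_of_apply, diamondSubst]
  | ih2 v w hv hw =>
    change ((FreeLieAlgebra.lift F (diamondSubst u) ⁅lieMonomial F v, lieMonomial F w⁆ :
      adjointLie (M11E F)) : Matrix (Fin 2) (Fin 2) (GrassmannOne F)) =
      ((((letters v + letters w).map (pairGen F)).prod : Subalgebra.center F (GrassmannOne F)) :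
        GrassmannOne F) • diamondMatrix F (FreeLieAlgebra.lift F u ⁅lieMonomial F v, lieMonomial F w⁆)
    rw [LieHom.map_lie, LieHom.map_lie, LieSubalgebra.coe_bracket,
      LieRing.of_associative_ring_bracket, hv, hw, diamondMatrix_lie, center_smul_mul_smul,
      center_smul_mul_smul, Multiset.map_add, Multiset.prod_add, smul_sub,
      mul_comm ((letters w).map (pairGen F)).prod]

theorem isIdentity_diamond {f : FreeLieAlgebra F ℕ} (hf : IsMultilinear f)
    (h : IsIdentity (adjointLie (M11E F)) f) : IsIdentity (Diamond F) f := by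
  obtain ⟨s, hf⟩ := hf
  intro u
  set H : GrassmannOne F :=
    (((s.val.map (pairGen F)).prod : Subalgebra.center F (GrassmannOne F)) : GrassmannOne F)
    with hH
  have key : ((FreeLieAlgebra.lift F (diamondSubst u) f : adjointLie (M11E F)) :
      Matrix (Fin 2) (Fin 2) (GrassmannOne F)) =
        H • diamondMatrix F (FreeLieAlgebra.lift F u f) := by
    clear h
    induction hf using Submodule.span_induction with
    | mem f hf =>
      obtain ⟨w, hw, rfl⟩ := hf
      rw [lift_diamondSubst_lieMonomial, letters_eq_val hw]
    | zero => simp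
    | add f g _ _ hf hg => rw [map_add, map_add, map_add, smul_add, ← hf, ← hg]; rfl
    | smul c f _ hf => rw [map_smul, map_smul, map_smul, smul_comm, ← hf]; rfl
  rw [h] at key
  have hne := pairGen_prod_mul_ne_zero (F := F) s
  rw [← hH] at hne
  have hzero : ∀ c : F, c • (H * (gen F 0 * gen F 1)) = 0 → c = 0 := fun c hc =>
    (smul_eq_zero.mp hc).resolve_right hne
  set v := FreeLieAlgebra.lift F u f
  have e : ∀ i j, H * diamondMatrix F v i j = 0 := fun i j =>
    (congrFun (congrFun key i) j).symm
  have e00 : H * (v.t • 1 + v.s • (gen F 0 * gen F 1)) = 0 := e 0 0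
  have e01 : H * (v.b • gen F 0) = 0 := e 0 1
  have e10 : H * (v.d • gen F 1) = 0 := e 1 0
  have e11 : H * (v.s • (gen F 0 * gen F 1)) = 0 := e 1 1
  have hs : v.s = 0 := hzero _ (by rwa [mul_smul_comm] at e11)
  rw [hs, zero_smul, add_zero] at e00
  have h10 : gen F 1 * gen F 0 = -(gen F 0 * gen F 1) := ι_mul_ι_swap _ _
  -- Each entry is multiplied by the generators it lacks, so that every coordinate stands before the
  -- same nonzero product `H * (gen F 0 * gen F 1)`, up to sign.
  ext
  · refine hzero _ ?_
    have := congrArg (· * (gen F 0 * gen F 1)) e00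
    simpa [mul_assoc] using this
  · refine hzero _ ?_
    have := congrArg (· * gen F 1) e01
    simpa [mul_assoc] using this
  · refine hzero _ ?_
    have := congrArg (· * gen F 0) e10
    simpa [mul_assoc, h10] using this
  · exact hs

theorem M11E_le_M11EOne : adjointLie (M11E F) ≤ adjointLie (M11EOne F) := by
  have hle : evenPart F ≤ evenPartOne F :=
    Submodule.span_mono fun _ ⟨l, hl, h⟩ => ⟨l, hl.1, h⟩
  rintro M ⟨⟨h1, h2⟩, h3, h4⟩
  exact ⟨⟨hle h1, hle h2⟩, h3, h4⟩

theorem isIdentity_of_injective {L P : Type*} [LieRing L] [LieAlgebra F L] [LieRing P]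
    [LieAlgebra F P] (g : L →ₗ⁅F⁆ P) (hg : Function.Injective g) {f : FreeLieAlgebra F ℕ}
    (hf : IsIdentity P f) : IsIdentity L f := by
  intro a
  have h : g.comp (FreeLieAlgebra.lift F a) = FreeLieAlgebra.lift F (g ∘ a) := by
    refine (FreeLieAlgebra.lift_unique _ _).mp ?_
    funext i
    simp [FreeLieAlgebra.lift_of_apply]
  refine hg ?_
  rw [map_zero, ← hf (g ∘ a), ← h]
  rfl

theorem isIdentity_M11E_of_M11EOne {f : FreeLieAlgebra F ℕ}
    (h : IsIdentity (adjointLie (M11EOne F)) f) : IsIdentity (adjointLie (M11E F)) f :=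
  isIdentity_of_injective (LieSubalgebra.inclusion M11E_le_M11EOne)
    (LieSubalgebra.inclusion_injective M11E_le_M11EOne) h

end Embedding

end LiePI

theorem proposition1 (F : Type*) [Field F] (hF : ringChar F ≠ 2) (f : FreeLieAlgebra F ℕ)
    (hf : LiePI.IsMultilinear f)
    (hid : LiePI.IsIdentity (LiePI.adjointLie (LiePI.M11E F)) f ∨
      LiePI.IsIdentity (LiePI.adjointLie (LiePI.M11EOne F)) f) :
    LiePI.IsConsequence f (LiePI.centreByMetabelian F) := by
  refine LiePI.isConsequence_of_diamond (Ring.two_ne_zero hF) hf (LiePI.isIdentity_diamond hf ?_)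
  exact hid.elim id LiePI.isIdentity_M11E_of_M11EOne
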